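/- Write $\mathcal U^m$ for the uniform distribution on $\{0,1\}^m$, $|x|$ for the Hamming weight of a bit string $x$, and $\|P-Q\|_{\mathrm{TV}}=\frac12\sum_x|P(x)-Q(x)|$ for the total variation distance. A function $f\colon\{0,1\}^m\to\{0,1\}^n$ is $d$-local if each of its output bits depends on at most $d$ of its input bits; a distribution on $\{0,1\}^n$ is symmetric if it is invariant under all permutations of the $n$ coordinates. **Proposition.** For every $d\in\mathbb N$ there are constants $c,C>0$ and $N\in\mathbb N$, depending only on $d$, such that the following holds for all $n\ge N$, all $m$, every $d$-local function $f\colon\{0,1\}^m\to\{0,1\}^n$, and every $\gamma\in(0,1)$ that is an integer multiple of $2^{-d}$. There are distributions $E$ and $W$ on $\{0,1\}^n$ and a number $\nu\in[0,1]$ such that $f(\mathcal U^m)=\nu E+(1-\nu)W$ and 1. $\|E-\mathcal D\|_{\mathrm{TV}}\ge 1-e^{-cn}$ for every symmetric distribution $\mathcal D$ on $\{0,1\}^n$ that is supported on strings $x$ with $\bigl||x|-\gamma n\bigr|\le n^{2/3}$; 2. for all $w\in\{0,1,\dots,n\}$ and all $\Delta\in\mathbb Z$ if $\gamma\ne\frac12$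 (respectively, all even $\Delta\in\mathbb Z$ if $\gamma=\frac12$), $$\Bigl|\Pr\bigl[|W|=w\bigr]-\Pr\bigl[|W|=w+\Delta\bigr]\Bigr|\le C\,\frac{|\Delta|}{n},$$ where $\Pr[|W|=w]$ denotes the probability that a string drawn from $W$ has Hamming weight $w$ (so it is $0$ for integers outside $\{0,\dots,n\}$). -/

import Mathlib

noncomputable section

/-- `f : {0,1}^m → {0,1}^n` is `d`-local: every output bit is determined by at most `d`
of the input bits. -/
def IsLocal {m n : ℕ} (d : ℕ) (f : (Fin m → Bool) → (Fin n → Bool)) : Prop :=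
  ∀ i : Fin n, ∃ S : Finset (Fin m), S.card ≤ d ∧ DependsOn (fun x => f x i) (S : Set (Fin m))

/-- The distribution `f(U^m)` of the output of `f` on a uniformly random input. -/
def outputDist {m n : ℕ} (f : (Fin m → Bool) → (Fin n → Bool)) : PMF (Fin n → Bool) :=
  (PMF.uniformOfFintype (Fin m → Bool)).map f

/-- The Hamming weight of a bit string. -/
def hammingWeight {n : ℕ} (x : Fin n → Bool) : ℕ :=
  (Finset.univ.filter (fun i => x i = true)).card

/-- The total variation distance of two distributions on a finite type. -/
def tvDist {α : Type*} [Fintype α] (P Q : PMF α) : ℝ :=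
  (1 / 2) * ∑ x, |(P x).toReal - (Q x).toReal|

/-- `P = ν E + (1 - ν) W` for some mixing weight `ν ∈ [0,1]`. -/
def IsMixture {α : Type*} (P E W : PMF α) : Prop :=
  ∃ ν : ℝ, 0 ≤ ν ∧ ν ≤ 1 ∧ ∀ x, (P x).toReal = ν * (E x).toReal + (1 - ν) * (W x).toReal

/-- A distribution on bit strings is symmetric if it is invariant under permutations of the
coordinates. -/
def IsSymmetricDist {n : ℕ} (D : PMF (Fin n → Bool)) : Prop :=
  ∀ (σ : Equiv.Perm (Fin n)) (x : Fin n → Bool), D (x ∘ σ) = D x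

/-- Every string in the support of `D` has Hamming weight within `r` of `c`. -/
def HasWeightsWithin {n : ℕ} (D : PMF (Fin n → Bool)) (c r : ℝ) : Prop :=
  ∀ x ∈ D.support, |(hammingWeight x : ℝ) - c| ≤ r

/-- `Pr[|X| = w]` for `X ∼ P`; it is `0` for integers `w` outside `{0, …, n}`. -/
def weightProb {n : ℕ} (P : PMF (Fin n → Bool)) (w : ℤ) : ℝ :=
  ∑ x with (hammingWeight x : ℤ) = w, (P x).toReal

end

/-! Fixing the inputs in a small set `S` splits `f` into at most `2 ^ |S|` restrictions.
`exists_disjoint_blocks` chooses `S` so that linearly many outputs, the set `R`, have bounded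
neighbourhoods (the outputs sharing an unfixed input with them) with pairwise disjoint, hence
independent, blocks of inputs. Moreover `|S|` is smaller than `|R|` by a prescribed factor that may
depend on the neighbourhood size. A restriction is assigned to `E` if at least half of these
neighbourhoods fail to have the law of independent `γ`-biased bits, and to `W` otherwise.

For `E`: probabilities of local events have bounded denominators, so a neighbourhood with the wrong
law is wrong by a constant on some event (`exists_event_of_not_isProductLaw`). Counting these events
over `R` gives, by a Chernoff bound, a test that separates the restriction from all product
distributions of bias near `γ` (`exists_separating_test`), and such distributions dominate symmetric
ones up to a factor `n + 1` (`IsSymmetricDist.sum_le`). Uniting the tests of all restrictions costs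
a factor `2 ^ |S|`, which the exponentially small errors absorb (`le_tvDist_of_separating_tests`).

For `W`: in a neighbourhood with the right law, the character `ω ^ weight` is correlated with the
central output, which is independent of the inputs it does not read. So the neighbourhood's weight
stays random given those other inputs (`IsProductLaw.le_one_sub_bexp`). Given all inputs not read by
central outputs, these characters are independent, so the characteristic function of the total
weight is at most `exp (-a * ‖ω ^ δ - 1‖ ^ 2)` with `a` of order `n`. Here `δ = 1`, except that `δ =
2` if `γ = 1 / 2`, where the parity of the weight may be constant. In Fourier inversion, the
difference of the probabilities at `w` and `w + δ` brings another factor `‖ω ^ δ - 1‖`, which makes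
the integral `O(1 / a)` (`abs_bexp_sub_bexp_le_of_char`). -/

open Finset

/-! ### Expectations over independent biased bits. -/

noncomputable section

/-- The probability of the bit string `x` when its bits are independent and equal to `true` with
probability `p`. -/
def bwt {ι : Type*} [Fintype ι] (p : ℝ) (x : ι → Bool) : ℝ := ∏ i, if x i then p else 1 - p

/-- The expectation of `g` over independent random bits with bias `p`. -/
def bexp {ι E : Type*} [Fintype ι] [DecidableEq ι] [AddCommGroup E] [Module ℝ E] (p : ℝ)
    (g : (ι → Bool) → E) : E := ∑ x, bwt p x • g x

section bexp

set_option linter.unusedSectionVars false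

variable {ι : Type*} [Fintype ι] [DecidableEq ι] {p : ℝ}

theorem bwt_nonneg (h0 : 0 ≤ p) (h1 : p ≤ 1) (x : ι → Bool) : 0 ≤ bwt p x :=
  Finset.prod_nonneg fun i _ => by split_ifs <;> linarith

theorem sum_prod_eq_prod_bool (v : ι → Bool → ℝ) :
    ∑ x : ι → Bool, ∏ i, v i (x i) = ∏ i, (v i true + v i false) := by
  have := Finset.prod_univ_sum (fun _ : ι => (Finset.univ : Finset Bool)) v
  simp only [Fintype.sum_bool, Fintype.piFinset_univ] at this
  exact this.symm

theorem sum_bwt : ∑ x : ι → Bool, bwt p x = 1 := by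
  unfold bwt
  rw [sum_prod_eq_prod_bool (fun _ b => if b then p else 1 - p)]
  simp

variable {E : Type*} [AddCommGroup E] [Module ℝ E]

theorem bexp_const (c : E) : bexp p (fun _ : ι → Bool => c) = c := by
  rw [bexp, ← Finset.sum_smul, sum_bwt, one_smul]

theorem bexp_add (g h : (ι → Bool) → E) :
    bexp p (fun x => g x + h x) = bexp p g + bexp p h := by
  simp [bexp, smul_add, Finset.sum_add_distrib]

theorem bexp_sub (g h : (ι → Bool) → E) :
    bexp p (fun x => g x - h x) = bexp p g - bexp p h := by
  simp [bexp, smul_sub, Finset.sum_sub_distrib]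

theorem bexp_sum {κ : Type*} (s : Finset κ) (g : κ → (ι → Bool) → E) :
    bexp p (fun x => ∑ k ∈ s, g k x) = ∑ k ∈ s, bexp p (g k) := by
  simp only [bexp, Finset.smul_sum]
  exact Finset.sum_comm

theorem bexp_map {E' : Type*} [AddCommGroup E'] [Module ℝ E'] (φ : E →ₗ[ℝ] E')
    (g : (ι → Bool) → E) : bexp p (fun x => φ (g x)) = φ (bexp p g) := by
  simp [bexp, map_sum]

theorem bexp_mul_left {A : Type*} [Ring A] [Algebra ℝ A] (c : A) (g : (ι → Bool) → A) :
    bexp p (fun x => c * g x) = c * bexp p g := bexp_map (LinearMap.mulLeft ℝ c) g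

theorem bexp_mul_right {A : Type*} [Ring A] [Algebra ℝ A] (c : A) (g : (ι → Bool) → A) :
    bexp p (fun x => g x * c) = bexp p g * c := bexp_map (LinearMap.mulRight ℝ c) g

theorem bexp_mono (h0 : 0 ≤ p) (h1 : p ≤ 1) {g h : (ι → Bool) → ℝ} (hgh : ∀ x, g x ≤ h x) :
    bexp p g ≤ bexp p h :=
  Finset.sum_le_sum fun x _ => mul_le_mul_of_nonneg_left (hgh x) (bwt_nonneg h0 h1 x)

theorem bexp_nonneg (h0 : 0 ≤ p) (h1 : p ≤ 1) {g : (ι → Bool) → ℝ} (hg : ∀ x, 0 ≤ g x) :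
    0 ≤ bexp p g :=
  Finset.sum_nonneg fun x _ => mul_nonneg (bwt_nonneg h0 h1 x) (hg x)

theorem bexp_le_one (h0 : 0 ≤ p) (h1 : p ≤ 1) {g : (ι → Bool) → ℝ} (hg : ∀ x, g x ≤ 1) :
    bexp p g ≤ 1 := (bexp_mono h0 h1 hg).trans_eq (bexp_const 1)

theorem norm_bexp_le (h0 : 0 ≤ p) (h1 : p ≤ 1) (g : (ι → Bool) → ℂ) :
    ‖bexp p g‖ ≤ bexp p (fun x => ‖g x‖) := by
  refine (norm_sum_le _ _).trans_eq (Finset.sum_congr rfl fun x _ => ?_)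
  rw [norm_smul, Real.norm_of_nonneg (bwt_nonneg h0 h1 x), smul_eq_mul]

theorem sq_bexp_le (h0 : 0 ≤ p) (h1 : p ≤ 1) (g : (ι → Bool) → ℝ) :
    (bexp p g) ^ 2 ≤ bexp p (fun x => g x ^ 2) := by
  have h := bexp_nonneg h0 h1 (g := fun x => (g x - bexp p g) ^ 2) fun x => sq_nonneg _
  have e : bexp p (fun x => (g x - bexp p g) ^ 2)
      = bexp p (fun x => g x ^ 2) - (bexp p g) ^ 2 := by
    have : (fun x => (g x - bexp p g) ^ 2)
        = fun x => g x ^ 2 - 2 * bexp p g * g x + bexp p g ^ 2 := by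
      funext x; ring
    rw [this, bexp_add, bexp_sub, bexp_mul_left, bexp_const]
    ring
  linarith

theorem bwt_piecewise_mul (A : Finset ι) (x y : ι → Bool) :
    bwt p (A.piecewise x y) * bwt p (A.piecewise y x) = bwt p x * bwt p y := by
  unfold bwt
  rw [← Finset.prod_mul_distrib, ← Finset.prod_mul_distrib]
  refine Finset.prod_congr rfl fun i _ => ?_
  by_cases h : i ∈ A
  · simp [h]
  · simp [h, mul_comm]

/-- Exchanging the coordinates in `A` of two independent copies preserves their joint law. -/
theorem bexp_swap (A : Finset ι) (G : (ι → Bool) → (ι → Bool) → E) :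
    bexp p (fun x => bexp p fun y => G x y)
      = bexp p fun x => bexp p fun y => G (A.piecewise x y) (A.piecewise y x) := by
  simp only [bexp, Finset.smul_sum, smul_smul]
  rw [← Fintype.sum_prod_type', ← Fintype.sum_prod_type']
  have hinv : Function.Involutive fun z : (ι → Bool) × (ι → Bool) =>
      (A.piecewise z.1 z.2, A.piecewise z.2 z.1) := by
    rintro ⟨x, y⟩
    ext i <;> by_cases h : i ∈ A <;> simp [h]
  rw [← Equiv.sum_comp hinv.toPerm]
  refine Finset.sum_congr rfl fun z _ => ?_
  simp [Function.Involutive.coe_toPerm, bwt_piecewise_mul]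

/-- Resampling the coordinates in `A` preserves the law. -/
theorem bexp_resample (A : Finset ι) (G : (ι → Bool) → E) :
    bexp p G = bexp p fun x => bexp p fun y => G (A.piecewise y x) := by
  rw [← bexp_swap A (fun _ y => G y), bexp_const]

theorem piecewise_eq_of_dependsOn {α : Type*} {G : (ι → Bool) → α} {A : Finset ι}
    (hG : DependsOn G (A : Set ι)) (x y : ι → Bool) : G (A.piecewise x y) = G x :=
  hG fun i hi => by simp [Finset.mem_coe.1 hi]

theorem piecewise_eq_of_dependsOn_disjoint {α : Type*} {G : (ι → Bool) → α} {A B : Finset ι}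
    (hG : DependsOn G (B : Set ι)) (hAB : Disjoint A B) (x y : ι → Bool) :
    G (A.piecewise x y) = G y :=
  hG fun i hi => by simp [Finset.disjoint_right.1 hAB (Finset.mem_coe.1 hi)]

section algebra

variable {𝕜 : Type*} [CommRing 𝕜] [Algebra ℝ 𝕜]

theorem bexp_mul_of_disjoint {g h : (ι → Bool) → 𝕜} {A B : Finset ι}
    (hg : DependsOn g (A : Set ι)) (hh : DependsOn h (B : Set ι)) (hAB : Disjoint A B) :
    bexp p (fun x => g x * h x) = bexp p g * bexp p h := by
  rw [bexp_resample A]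
  simp only [piecewise_eq_of_dependsOn hg, piecewise_eq_of_dependsOn_disjoint hh hAB,
    bexp_mul_right, bexp_mul_left]

theorem dependsOn_prod {κ : Type*} (R : Finset κ) {u : κ → (ι → Bool) → 𝕜}
    {B : κ → Finset ι} (hu : ∀ j ∈ R, DependsOn (u j) (B j : Set ι)) :
    DependsOn (fun x => ∏ j ∈ R, u j x) ((R.biUnion B : Finset ι) : Set ι) := by
  intro x y hxy
  refine Finset.prod_congr rfl fun j hj => hu j hj fun i hi => hxy i ?_
  exact Finset.mem_coe.2 (Finset.mem_biUnion.2 ⟨j, hj, hi⟩)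

theorem bexp_prod_of_disjoint {κ : Type*} [DecidableEq κ] (R : Finset κ)
    {u : κ → (ι → Bool) → 𝕜} {B : κ → Finset ι} (hu : ∀ j ∈ R, DependsOn (u j) (B j : Set ι))
    (hB : ∀ j ∈ R, ∀ k ∈ R, j ≠ k → Disjoint (B j) (B k)) :
    bexp p (fun x => ∏ j ∈ R, u j x) = ∏ j ∈ R, bexp p (u j) := by
  induction R using Finset.induction_on with
  | empty => simp [bexp_const]
  | insert a R ha ih =>
    simp only [Finset.prod_insert ha]
    rw [bexp_mul_of_disjoint (hu a (Finset.mem_insert_self a R))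
      (dependsOn_prod R fun j hj => hu j (Finset.mem_insert_of_mem hj)),
      ih (fun j hj => hu j (Finset.mem_insert_of_mem hj))
        (fun j hj k hk => hB j (Finset.mem_insert_of_mem hj) k (Finset.mem_insert_of_mem hk))]
    rw [Finset.disjoint_biUnion_right]
    intro j hj
    exact hB a (Finset.mem_insert_self a R) j (Finset.mem_insert_of_mem hj)
      (fun e => ha (e ▸ hj))

end algebra

theorem bexp_coord_indicator (i : ι) :
    bexp p (fun x : ι → Bool => if x i then (1 : ℝ) else 0) = p := by
  have h := sum_prod_eq_prod_bool (ι := ι)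
    (fun k b => (if b then p else 1 - p) * if k = i then (if b then 1 else 0) else 1)
  have e : ∀ x : ι → Bool, ∏ k, ((if x k then p else 1 - p) *
      if k = i then (if x k then (1 : ℝ) else 0) else 1)
      = bwt p x * if x i then 1 else 0 := by
    intro x
    rw [Finset.prod_mul_distrib, Finset.prod_ite_eq' Finset.univ i]
    simp [bwt]
  simp only [e] at h
  simp only [bexp, smul_eq_mul, h]
  rw [Finset.prod_eq_single i (fun k _ hk => by simp [hk]) (by simp)]
  simp

/-- Every function of one bit is affine in the indicator of that bit. -/
theorem bexp_coord (i : ι) (u : Bool → E) :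
    bexp p (fun x : ι → Bool => u (x i)) = p • u true + (1 - p) • u false := by
  have e : (fun x : ι → Bool => u (x i)) = fun x =>
      LinearMap.toSpanSingleton ℝ E (u true - u false) (if x i then (1 : ℝ) else 0) + u false := by
    funext x
    cases x i <;> simp
  rw [e, bexp_add, bexp_map, bexp_coord_indicator, bexp_const]
  simp only [LinearMap.toSpanSingleton_apply]
  module

theorem bexp_update (i : ι) (G : (ι → Bool) → E) :
    bexp p G = p • bexp p (fun x => G (Function.update x i true))
      + (1 - p) • bexp p (fun x => G (Function.update x i false)) := by
  have e : ∀ x : ι → Bool, bexp p (fun y => G (Finset.piecewise {i} y x))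
      = p • G (Function.update x i true) + (1 - p) • G (Function.update x i false) := by
    intro x
    simp only [Finset.piecewise_singleton]
    exact bexp_coord i fun b => G (Function.update x i b)
  rw [bexp_resample {i}, funext e, bexp_add]
  exact congrArg₂ _ (bexp_map (LinearMap.lsmul ℝ E p) _) (bexp_map (LinearMap.lsmul ℝ E (1 - p)) _)

theorem bexp_prod_coord {𝕜 : Type*} [CommRing 𝕜] [Algebra ℝ 𝕜] (N : Finset ι)
    (u : ι → Bool → 𝕜) :
    bexp p (fun x : ι → Bool => ∏ i ∈ N, u i (x i))
      = ∏ i ∈ N, (p • u i true + (1 - p) • u i false) := by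
  rw [bexp_prod_of_disjoint N (u := fun i x => u i (x i)) (B := fun i => {i})]
  · exact Finset.prod_congr rfl fun i _ => bexp_coord i (u i)
  · intro j _ x y hxy
    simp only [hxy j (by simp)]
  · intro j _ k _ hjk
    simpa using hjk

theorem dependsOn_update {α : Type*} {G : (ι → Bool) → α} {i : ι} {N : Finset ι}
    (hG : DependsOn G ((insert i N : Finset ι) : Set ι)) (b : Bool) :
    DependsOn (fun x => G (Function.update x i b)) (N : Set ι) := by
  intro x y hxy
  refine hG fun k hk => ?_
  by_cases h : k = i
  · subst h; simp
  · simp only [Function.update_of_ne h]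
    exact hxy k (by simpa [h] using hk)

theorem bexp_of_dependsOn_empty {G : (ι → Bool) → E} (hG : DependsOn G (∅ : Set ι))
    (z : ι → Bool) : bexp p G = G z := by
  have : G = fun _ => G z := funext fun x => hG (by simp)
  rw [this, bexp_const]

/-- Expectations of functions of few biased bits have bounded denominators. -/
theorem exists_int_bexp {d : ℕ} {a : ℤ} (hp : p = a / 2 ^ d) (N : Finset ι)
    {G : (ι → Bool) → ℝ} (hG : DependsOn G (N : Set ι)) (hz : ∀ x, ∃ z : ℤ, G x = z) :
    ∃ z : ℤ, bexp p G = z / 2 ^ (d * N.card) := by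
  induction N using Finset.induction_on generalizing G with
  | empty =>
    obtain ⟨z, hz⟩ := hz fun _ => false
    exact ⟨z, by rw [bexp_of_dependsOn_empty (by simpa using hG) fun _ => false, hz]; simp⟩
  | insert i N hi ih =>
    obtain ⟨z₁, h₁⟩ := ih (dependsOn_update hG true) fun x => hz _
    obtain ⟨z₀, h₀⟩ := ih (dependsOn_update hG false) fun x => hz _
    refine ⟨a * z₁ + (2 ^ d - a) * z₀, ?_⟩
    rw [bexp_update i, h₁, h₀, Finset.card_insert_of_notMem hi, hp, mul_add, mul_one, pow_add]
    simp only [smul_eq_mul]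
    push_cast
    field_simp

/-- Expectations of functions of few biased bits are Lipschitz in the bias. -/
theorem abs_bexp_sub_bexp_le {q : ℝ} (hp0 : 0 ≤ p) (hp1 : p ≤ 1) (hq0 : 0 ≤ q) (hq1 : q ≤ 1)
    (N : Finset ι) {G : (ι → Bool) → ℝ} (hG : DependsOn G (N : Set ι)) (h0 : ∀ x, 0 ≤ G x)
    (h1 : ∀ x, G x ≤ 1) : |bexp p G - bexp q G| ≤ N.card * |p - q| := by
  induction N using Finset.induction_on generalizing G with
  | empty =>
    have hG' : DependsOn G (∅ : Set ι) := by simpa using hG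
    rw [bexp_of_dependsOn_empty hG' fun _ => false, bexp_of_dependsOn_empty hG' fun _ => false]
    simp
  | insert i N hi ih =>
    have a₁ := ih (dependsOn_update hG true) (fun x => h0 _) fun x => h1 _
    have a₀ := ih (dependsOn_update hG false) (fun x => h0 _) fun x => h1 _
    rw [bexp_update i G, bexp_update (p := q) i G, Finset.card_insert_of_notMem hi]
    set P₁ := bexp p fun x => G (Function.update x i true)
    set P₀ := bexp p fun x => G (Function.update x i false)
    set Q₁ := bexp q fun x => G (Function.update x i true)
    set Q₀ := bexp q fun x => G (Function.update x i false)
    have b₁ : 0 ≤ P₁ := bexp_nonneg hp0 hp1 fun x => h0 _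
    have b₂ : P₁ ≤ 1 := bexp_le_one hp0 hp1 fun x => h1 _
    have b₃ : 0 ≤ P₀ := bexp_nonneg hp0 hp1 fun x => h0 _
    have b₄ : P₀ ≤ 1 := bexp_le_one hp0 hp1 fun x => h1 _
    simp only [smul_eq_mul]
    -- Change the bias of coordinate `i` first, then that of the coordinates in `N`.
    have e : p * P₁ + (1 - p) * P₀ - (q * Q₁ + (1 - q) * Q₀)
        = (p - q) * (P₁ - P₀) + (q * (P₁ - Q₁) + (1 - q) * (P₀ - Q₀)) := by ring
    rw [e]
    refine (abs_add_le _ _).trans ?_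
    have c₁ : |(p - q) * (P₁ - P₀)| ≤ |p - q| := by
      rw [abs_mul]
      exact mul_le_of_le_one_right (abs_nonneg _) (abs_le.2 ⟨by linarith, by linarith⟩)
    have c₂ : |q * (P₁ - Q₁) + (1 - q) * (P₀ - Q₀)| ≤ N.card * |p - q| := by
      refine (abs_add_le _ _).trans ?_
      rw [abs_mul, abs_mul, abs_of_nonneg hq0, abs_of_nonneg (by linarith : (0:ℝ) ≤ 1 - q)]
      nlinarith
    push_cast
    linarith

end bexp


/-! ### The input-output graph: disjoint blocks after deleting few inputs. -/

section graph

variable {V X : Type*} [Fintype V] [DecidableEq V] [Fintype X] [DecidableEq X]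

/-- The outputs that share an input with the output `i`, where `T j` is the set of inputs of the
output `j`, together with `i` itself. -/
def nbhd (T : V → Finset X) (i : V) : Finset V :=
  univ.filter fun j => j = i ∨ ¬ Disjoint (T i) (T j)

/-- The inputs of the outputs in the neighbourhood of `i`. -/
def block (T : V → Finset X) (i : V) : Finset X := (nbhd T i).biUnion T

/-- The outputs that depend on the input `x`. -/
def outputsOf (T : V → Finset X) (x : X) : Finset V := univ.filter fun i => x ∈ T i

set_option linter.unusedSectionVars false

theorem card_block_le {T : V → Finset X} {d t : ℕ} (hT : ∀ i, (T i).card ≤ d) {i : V}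
    (hi : (nbhd T i).card ≤ t) : (block T i).card ≤ t * d :=
  (Finset.card_biUnion_le_card_mul _ _ d fun j _ => hT j).trans (Nat.mul_le_mul_right d hi)

theorem card_insert_biUnion_outputsOf_le (T : V → Finset X) {d L : ℕ} (i : V) {A : Finset X}
    (hA : A.card ≤ d) (hL : ∀ x ∈ A, (outputsOf T x).card ≤ L) :
    (insert i (A.biUnion (outputsOf T))).card ≤ d * L + 1 :=
  (Finset.card_insert_le _ _).trans <| Nat.succ_le_succ <|
    (Finset.card_biUnion_le_card_mul _ _ L hL).trans (Nat.mul_le_mul_right L hA)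

/-- The extra one accounts for `i` itself, which may have no inputs. -/
theorem card_nbhd_le {T : V → Finset X} {d L : ℕ} {i : V} (hT : (T i).card ≤ d)
    (hL : ∀ x ∈ T i, (outputsOf T x).card ≤ L) : (nbhd T i).card ≤ d * L + 1 := by
  refine (Finset.card_le_card ?_).trans (card_insert_biUnion_outputsOf_le T i hT hL)
  intro j hj
  simp only [nbhd, mem_filter, mem_univ, true_and] at hj
  rcases hj with rfl | hj
  · exact mem_insert_self _ _
  · obtain ⟨x, hx, hx'⟩ := Finset.not_disjoint_iff.1 hj
    exact mem_insert_of_mem (mem_biUnion.2 ⟨x, hx, by simpa [outputsOf] using hx'⟩)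

/-- A maximal family of outputs with disjoint blocks: the inputs of these blocks meet the inputs
of a positive fraction of the outputs. -/
theorem exists_maximal_disjoint_blocks (T : V → Finset X) {d L : ℕ} (hT : ∀ i, (T i).card ≤ d)
    (M : Finset V) (hM : ∀ i ∈ M, ∀ x ∈ T i, (outputsOf T x).card ≤ L) :
    ∃ R ⊆ M, (∀ i ∈ R, ∀ j ∈ R, i ≠ j → Disjoint (block T i) (block T j)) ∧
      M.card ≤ R.card +
        (univ.filter fun i => ¬ Disjoint (T i) (R.biUnion (block T))).card * (d * L + 1) := by
  classical
  obtain ⟨R, hR, hmax⟩ := Finset.exists_max_image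
    (M.powerset.filter fun R => ∀ i ∈ R, ∀ j ∈ R, i ≠ j → Disjoint (block T i) (block T j))
    Finset.card ⟨∅, by simp⟩
  simp only [mem_filter, mem_powerset] at hR hmax
  refine ⟨R, hR.1, hR.2, ?_⟩
  set Q := R.biUnion (block T)
  set H := univ.filter fun i => ¬ Disjoint (T i) Q
  -- Otherwise `insert i R` would contradict the maximality of `R`.
  have hmeet : ∀ i ∈ M, i ∉ R → ¬ Disjoint (block T i) Q := by
    intro i hi hiR hdis
    have hd : ∀ j ∈ R, Disjoint (block T i) (block T j) :=
      fun j hj => Finset.disjoint_of_subset_right (Finset.subset_biUnion_of_mem _ hj) hdis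
    have := hmax (insert i R) ⟨Finset.insert_subset hi hR.1, by
      intro a ha b hb hab
      rcases mem_insert.1 ha with ha | ha <;> rcases mem_insert.1 hb with hb | hb
      · exact absurd (ha.trans hb.symm) hab
      · exact ha ▸ hd b hb
      · exact hb ▸ (hd a ha).symm
      · exact hR.2 a ha b hb hab⟩
    rw [Finset.card_insert_of_notMem hiR] at this
    omega
  have hsub : M ⊆ R ∪ H.biUnion fun k => M.filter fun i => k ∈ nbhd T i := by
    intro i hi
    by_cases hiR : i ∈ R
    · exact mem_union_left _ hiR
    refine mem_union_right _ ?_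
    obtain ⟨x, hx, hxQ⟩ := Finset.not_disjoint_iff.1 (hmeet i hi hiR)
    obtain ⟨k, hk, hxk⟩ := mem_biUnion.1 hx
    exact mem_biUnion.2 ⟨k, by
      simpa [H] using Finset.not_disjoint_iff.2 ⟨x, hxk, hxQ⟩, mem_filter.2 ⟨hi, hk⟩⟩
  refine (Finset.card_le_card hsub).trans ((Finset.card_union_le _ _).trans ?_)
  refine Nat.add_le_add_left (Finset.card_biUnion_le_card_mul _ _ _ fun k _ => ?_) _
  -- The output `k` need not lie in `M`, so only its inputs of degree at most `L` are kept; an input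
  -- shared with some `i ∈ M` is among them.
  refine (Finset.card_le_card ?_).trans (card_insert_biUnion_outputsOf_le T k (d := d) (L := L)
    (A := (T k).filter fun x => (outputsOf T x).card ≤ L)
    ((Finset.card_filter_le _ _).trans (hT k)) (by simp))
  intro i hi
  simp only [nbhd, mem_filter, mem_univ, true_and] at hi
  rcases hi with ⟨hiM, rfl | hk⟩
  · exact mem_insert_self _ _
  · obtain ⟨x, hxi, hxk⟩ := Finset.not_disjoint_iff.1 hk
    exact mem_insert_of_mem (mem_biUnion.2 ⟨x, by simpa [hxk] using hM i hiM x hxi,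
      by simpa [outputsOf] using hxi⟩)

theorem sum_card_sdiff_add_le (T : V → Finset X) (Q : Finset X) :
    ∑ i, (T i \ Q).card + (univ.filter fun i => ¬ Disjoint (T i) Q).card
      ≤ ∑ i, (T i).card := by
  rw [Finset.card_filter, ← Finset.sum_add_distrib]
  refine Finset.sum_le_sum fun i _ => ?_
  split_ifs with h
  · rw [Finset.sdiff_eq_self_of_disjoint h]; simp
  · obtain ⟨x, hx, hxQ⟩ := Finset.not_disjoint_iff.1 h
    refine Nat.succ_le_of_lt (Finset.card_lt_card ⟨Finset.sdiff_subset, fun hs => ?_⟩)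
    exact (Finset.mem_sdiff.1 (hs hx)).2 hxQ

theorem outputsOf_sdiff_card_le (T : V → Finset X) (S : Finset X) (x : X) :
    (outputsOf (fun i => T i \ S) x).card ≤ (outputsOf T x).card := by
  refine Finset.card_le_card fun i hi => ?_
  simp only [outputsOf, mem_filter, mem_univ, true_and, mem_sdiff] at hi ⊢
  exact hi.1

/-- An iteration that runs out of edges. Write `n` for the number of outputs and `t = d * L + 1`.
Starting from `S₀`, take a maximal family `R` with disjoint blocks. If `R` is too small compared
with `S`, add all inputs of its blocks to `S`: this multiplies the bound on `|S|` by at most `A = 1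
+ d * t * F`. As `R` has at most `n / 4` elements, maximality forces at least `n / (4 * t)` outputs
to lose an input. Only `d * n` edges are available, so fewer than `J` rounds are possible. -/
theorem exists_blocks_of_scale (T : V → Finset X) {d L F J : ℕ} (hT : ∀ i, (T i).card ≤ d)
    (hV : 0 < Fintype.card V) (M : Finset V) (hM : Fintype.card V ≤ 2 * M.card) (S₀ : Finset X)
    (hS₀ : ∀ i ∈ M, ∀ x ∈ T i, x ∉ S₀ → (outputsOf T x).card ≤ L) {s : ℝ} (hs : 0 < s)
    (hS₀s : (S₀.card : ℝ) ≤ s * Fintype.card V) (hJ : 4 * d * (d * L + 1) < J)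
    (hsJ : F * (s * (1 + d * (d * L + 1) * F) ^ J) ≤ 1 / 4) :
    ∃ (S : Finset X) (R : Finset V),
      (∀ i ∈ R, (nbhd (fun i => T i \ S) i).card ≤ d * L + 1) ∧
      (∀ i ∈ R, ∀ j ∈ R, i ≠ j →
        Disjoint (block (fun i => T i \ S) i) (block (fun i => T i \ S) j)) ∧
      F * S.card ≤ R.card ∧ F * (s * Fintype.card V) ≤ R.card := by
  by_contra! hcon
  set n : ℝ := (Fintype.card V : ℝ) with hn
  have hn0 : 0 < n := hn ▸ Nat.cast_pos.2 hV
  set t : ℝ := d * L + 1 with ht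
  have ht0 : 0 < t := by positivity
  set A : ℝ := 1 + d * t * F with hA
  have hA1 : 1 ≤ A := by
    have : 0 ≤ d * t * F := by positivity
    linarith
  clear_value n t A
  have key : ∀ j ≤ J, ∃ S, S₀ ⊆ S ∧ (S.card : ℝ) ≤ s * A ^ j * n ∧
      ((∑ i, (T i \ S).card : ℕ) : ℝ) + j * (n / (4 * t)) ≤ d * n := by
    intro j
    induction j with
    | zero =>
      refine fun _ => ⟨S₀, subset_rfl, by simpa using hS₀s, ?_⟩
      have : ∑ i, (T i \ S₀).card ≤ Fintype.card V * d := by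
        refine (Finset.sum_le_card_nsmul _ _ d fun i _ =>
          (Finset.card_le_card Finset.sdiff_subset).trans (hT i)).trans_eq ?_
        simp [Finset.card_univ]
      have : ((∑ i, (T i \ S₀).card : ℕ) : ℝ) ≤ n * d := by
        rw [hn]; exact_mod_cast this
      simp only [CharP.cast_eq_zero, zero_mul, add_zero]
      linarith
    | succ j ih =>
      intro hj
      obtain ⟨S, hS, hcard, hedges⟩ := ih (by omega)
      have hT' : ∀ i, (T i \ S).card ≤ d :=
        fun i => (Finset.card_le_card Finset.sdiff_subset).trans (hT i)
      have hL : ∀ i ∈ M, ∀ x ∈ T i \ S, (outputsOf (fun i => T i \ S) x).card ≤ L := by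
        intro i hi x hx
        rw [Finset.mem_sdiff] at hx
        exact (outputsOf_sdiff_card_le T S x).trans (hS₀ i hi x hx.1 fun h => hx.2 (hS h))
      obtain ⟨R, hRM, hdis, hle⟩ := exists_maximal_disjoint_blocks (fun i => T i \ S) hT' M hL
      have hnb : ∀ i ∈ R, (nbhd (fun i => T i \ S) i).card ≤ d * L + 1 :=
        fun i hi => card_nbhd_le (hT' i) (hL i (hRM hi))
      set Q := R.biUnion (block fun i => T i \ S)
      have hR : (R.card : ℝ) < F * (s * A ^ j * n) := by
        by_contra! hge
        have h1 : s * n ≤ s * A ^ j * n := by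
          refine mul_le_mul_of_nonneg_right ?_ hn0.le
          exact le_mul_of_one_le_right hs.le (one_le_pow₀ hA1)
        have h2 : ((F * S.card : ℕ) : ℝ) ≤ R.card := by
          push_cast
          exact (mul_le_mul_of_nonneg_left hcard (by positivity)).trans hge
        have h3 := hcon S R hnb hdis (by exact_mod_cast h2)
        exact absurd ((mul_le_mul_of_nonneg_left h1 (by positivity)).trans hge) (not_le.2 h3)
      have hQ : (Q.card : ℝ) ≤ R.card * (d * t) := by
        have : Q.card ≤ R.card * ((d * L + 1) * d) :=
          Finset.card_biUnion_le_card_mul _ _ _ fun i hi => card_block_le hT' (hnb i hi)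
        have : (Q.card : ℝ) ≤ R.card * ((d * L + 1) * d) := by exact_mod_cast this
        rw [ht]; linarith
      refine ⟨S ∪ Q, hS.trans Finset.subset_union_left, ?_, ?_⟩
      · have h1 : ((S ∪ Q).card : ℝ) ≤ S.card + Q.card := by
          exact_mod_cast Finset.card_union_le S Q
        have h2 : (R.card : ℝ) * (d * t) ≤ F * (s * A ^ j * n) * (d * t) :=
          mul_le_mul_of_nonneg_right hR.le (by positivity)
        have e : s * A ^ (j + 1) * n = s * A ^ j * n + F * (s * A ^ j * n) * (d * t) := by
          rw [pow_succ]; nth_rewrite 2 [hA]; ring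
        linarith
      · have h1 := sum_card_sdiff_add_le (fun i => T i \ S) Q
        set H := (univ.filter fun i => ¬ Disjoint (T i \ S) Q).card
        have e : ∑ i, ((T i \ S) \ Q).card = ∑ i, (T i \ (S ∪ Q)).card :=
          Finset.sum_congr rfl fun i _ => congrArg _ (by ext; simp; tauto)
        rw [e] at h1
        have h1' : ((∑ i, (T i \ (S ∪ Q)).card : ℕ) : ℝ) + H
            ≤ ((∑ i, (T i \ S).card : ℕ) : ℝ) := by exact_mod_cast h1
        have h2 : (M.card : ℝ) ≤ R.card + H * t := by rw [ht]; exact_mod_cast hle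
        have h3 : n ≤ 2 * M.card := by rw [hn]; exact_mod_cast hM
        have h4 : F * (s * A ^ j * n) ≤ n / 4 := by
          have h5 : F * (s * A ^ j) ≤ F * (s * A ^ J) := by
            have : A ^ j ≤ A ^ J := pow_le_pow_right₀ hA1 (by omega)
            gcongr
          have : F * (s * A ^ j * n) = F * (s * A ^ j) * n := by ring
          rw [this]
          have := mul_le_mul_of_nonneg_right (h5.trans hsJ) hn0.le
          linarith
        have h6 : n / (4 * t) ≤ H := by
          rw [div_le_iff₀ (by positivity)]
          linarith
        push_cast at h1' hedges ⊢
        linarith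
  obtain ⟨S, -, -, h⟩ := key J le_rfl
  have hJ' : 4 * d * t < J := by rw [ht]; exact_mod_cast hJ
  have h1 : (0 : ℝ) ≤ ((∑ i, (T i \ S).card : ℕ) : ℝ) := by positivity
  have h2 : (J : ℝ) * (n / (4 * t)) ≤ d * n := by linarith
  rw [← mul_div_assoc, div_le_iff₀ (mul_pos four_pos ht0)] at h2
  have h3 := mul_lt_mul_of_pos_right hJ' hn0
  linarith

theorem sum_card_outputsOf (T : V → Finset X) :
    ∑ x, (outputsOf T x).card = ∑ i, (T i).card := by
  simp only [outputsOf, Finset.card_filter]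
  rw [Finset.sum_comm]
  simp

/-- For an increasing sequence of scales, some interval of degrees is avoided by the inputs of half
of the outputs. -/
theorem exists_sparse_scale (T : V → Finset X) {d : ℕ} (hT : ∀ i, (T i).card ≤ d) {l : ℕ → ℕ}
    (hl : Monotone l) : ∃ k < 2 * d + 1, Fintype.card V ≤ 2 * (univ.filter fun i => ∀ x ∈ T i,
      l (k + 1) < (outputsOf T x).card ∨ (outputsOf T x).card ≤ l k).card := by
  by_contra! hcon
  have h1 : ∀ k ∈ range (2 * d + 1), Fintype.card V + 1 ≤ 2 * (univ.filter fun i => ∃ x ∈ T i,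
      l k < (outputsOf T x).card ∧ (outputsOf T x).card ≤ l (k + 1)).card := by
    intro k hk
    have h := hcon k (mem_range.1 hk)
    have e := Finset.card_filter_add_card_filter_not (s := (univ : Finset V)) (fun i => ∀ x ∈ T i,
      l (k + 1) < (outputsOf T x).card ∨ (outputsOf T x).card ≤ l k)
    rw [Finset.card_univ] at e
    have e' : (univ.filter fun i => ¬ ∀ x ∈ T i,
      l (k + 1) < (outputsOf T x).card ∨ (outputsOf T x).card ≤ l k)
      = univ.filter fun i => ∃ x ∈ T i,
        l k < (outputsOf T x).card ∧ (outputsOf T x).card ≤ l (k + 1) := by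
      ext i
      simp only [mem_filter, mem_univ, true_and]
      push Not
      exact exists_congr fun x => and_congr_right fun _ => and_comm
    rw [e'] at e
    omega
  have h2 := Finset.sum_le_sum h1
  rw [← Finset.mul_sum] at h2
  -- The degree intervals are disjoint, so each input of `i` is charged to at most one scale, and
  -- `i` is spoilt at no more than `d` of the `2 * d + 1` scales.
  have h3 : ∑ k ∈ range (2 * d + 1), (univ.filter fun i => ∃ x ∈ T i,
      l k < (outputsOf T x).card ∧ (outputsOf T x).card ≤ l (k + 1)).card
      ≤ ∑ i, (T i).card := by
    simp only [Finset.card_filter]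
    rw [Finset.sum_comm]
    refine Finset.sum_le_sum fun i _ => ?_
    rw [← Finset.card_filter]
    have : ∀ k ∈ (range (2 * d + 1)).filter fun k => ∃ x ∈ T i,
        l k < (outputsOf T x).card ∧ (outputsOf T x).card ≤ l (k + 1), ∃ x ∈ T i,
        l k < (outputsOf T x).card ∧ (outputsOf T x).card ≤ l (k + 1) :=
      fun k hk => (mem_filter.1 hk).2
    refine Finset.card_le_card_of_forall_subsingleton (fun k x =>
      l k < (outputsOf T x).card ∧ (outputsOf T x).card ≤ l (k + 1)) this ?_
    intro x _ a ha b hb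
    simp only [Set.mem_ofPred_eq] at ha hb
    rcases lt_trichotomy a b with h | h | h
    · have := hl (Nat.succ_le_of_lt h); simp only [Nat.succ_eq_add_one] at this; omega
    · exact h
    · have := hl (Nat.succ_le_of_lt h); simp only [Nat.succ_eq_add_one] at this; omega
  have h4 : ∑ i, (T i).card ≤ Fintype.card V * d := by
    refine (Finset.sum_le_card_nsmul _ _ d fun i _ => hT i).trans_eq ?_
    simp [Finset.card_univ]
  simp only [Finset.sum_const, card_range, smul_eq_mul] at h2
  nlinarith

end graph

/-- The degree scales used to find sparsely connected outputs. -/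
def degScale (d : ℕ) (F : ℕ → ℕ) : ℕ → ℕ
  | 0 => 0
  | k + 1 =>
    let t := d * degScale d F k + 1
    degScale d F k + 4 * (d + 1) * F t * (1 + d * t * F t) ^ (4 * d * t + 1)

/-- After deleting few inputs of a bipartite graph with bounded output degrees, linearly many
outputs have small neighbourhoods that share no inputs. -/
theorem exists_disjoint_blocks (d : ℕ) (F : ℕ → ℕ) (hF : ∀ t, 1 ≤ F t) :
    ∃ K : ℕ, 0 < K ∧ ∀ (n m : ℕ) (T : Fin n → Finset (Fin m)), (∀ i, (T i).card ≤ d) →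
      ∃ t ≤ K, ∃ (S : Finset (Fin m)) (R : Finset (Fin n)),
      (∀ i ∈ R, (nbhd (fun i => T i \ S) i).card ≤ t) ∧
      (∀ i ∈ R, ∀ j ∈ R, i ≠ j →
        Disjoint (block (fun i => T i \ S) i) (block (fun i => T i \ S) j)) ∧
      F t * S.card ≤ R.card ∧ n ≤ K * R.card := by
  have hl : Monotone (degScale d F) := monotone_nat_of_le_succ fun k => by
    simp only [degScale]; omega
  -- This `K` bounds both `t = d * L + 1` and the factor `L'` in the final inequality `n ≤ R.card *
  -- L'`, at every scale that can occur.
  refine ⟨(d + 1) * degScale d F (2 * d + 1) + 1, by omega, fun n m T hT => ?_⟩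
  rcases Nat.eq_zero_or_pos n with rfl | hn
  · exact ⟨0, by omega, ∅, ∅, by simp⟩
  obtain ⟨k, hk, hM⟩ := exists_sparse_scale T hT hl
  set L := degScale d F k
  set t := d * L + 1 with ht
  set L' := degScale d F (k + 1) with hL'
  have hL'e : L' = L + 4 * (d + 1) * F t * (1 + d * t * F t) ^ (4 * d * t + 1) := rfl
  have hL'max : L' ≤ degScale d F (2 * d + 1) := hl (by omega)
  have hmain : 4 * (d + 1) * F t * (1 + d * t * F t) ^ (4 * d * t + 1) ≤ L' := by omega
  have hL'0 : 0 < L' := by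
    refine lt_of_lt_of_le ?_ hmain
    have := hF t
    positivity
  have hL'r : (0 : ℝ) < L' := by exact_mod_cast hL'0
  have hS : (univ.filter fun x => L' < (outputsOf T x).card).card * L' ≤ n * d := by
    calc _ = ∑ x ∈ univ.filter fun x => L' < (outputsOf T x).card, L' := by simp
      _ ≤ ∑ x ∈ univ.filter fun x => L' < (outputsOf T x).card, (outputsOf T x).card :=
        Finset.sum_le_sum fun x hx => (mem_filter.1 hx).2.le
      _ ≤ ∑ x, (outputsOf T x).card := Finset.sum_le_sum_of_subset (Finset.filter_subset _ _)
      _ = ∑ i, (T i).card := sum_card_outputsOf T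
      _ ≤ n * d := by
        refine (Finset.sum_le_card_nsmul _ _ d fun i _ => hT i).trans_eq ?_
        simp
  obtain ⟨S, R, h1, h2, h3, h4⟩ := exists_blocks_of_scale T (L := L) (F := F t)
    (J := 4 * d * t + 1) hT (by simpa using hn) _ hM
    (univ.filter fun x => L' < (outputsOf T x).card)
    (by
      intro i hi x hx hxS
      simp only [mem_filter, mem_univ, true_and] at hi hxS
      exact (hi x hx).resolve_left hxS)
    -- At most `n * d / L'` inputs have degree above `L'`. Taking `d + 1` instead of `d` keeps `s`
    -- positive for `d = 0`, so that `R` has linear size in that case too.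
    (s := (d + 1) / L') (by positivity)
    (by
      rw [div_mul_eq_mul_div, le_div_iff₀ hL'r]
      have : ((univ.filter fun x => L' < (outputsOf T x).card).card : ℝ) * L' ≤ n * d := by
        exact_mod_cast hS
      simp only [Fintype.card_fin]
      have : (0 : ℝ) ≤ n := by positivity
      linarith)
    (Nat.lt_succ_self _)
    (by
      have : (4 * (d + 1) * F t * (1 + d * t * F t) ^ (4 * d * t + 1) : ℝ) ≤ L' := by
        exact_mod_cast hmain
      have e : (t : ℝ) = d * L + 1 := by rw [ht]; push_cast; rfl
      rw [← e, div_mul_eq_mul_div, mul_div_assoc', div_le_iff₀ hL'r]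
      linarith)
  refine ⟨t, ?_, S, R, h1, h2, h3, ?_⟩
  · have : L ≤ degScale d F (2 * d + 1) := hl (by omega)
    rw [ht]
    nlinarith
  · simp only [Fintype.card_fin] at h4
    rw [div_mul_eq_mul_div, mul_div_assoc', div_le_iff₀ hL'r] at h4
    have h5 : (n : ℝ) ≤ F t * ((d + 1) * n) := by
      have : (1 : ℝ) ≤ F t := by exact_mod_cast hF t
      have h0 : (0 : ℝ) ≤ (d + 1) * n := by positivity
      have h6 : (0 : ℝ) ≤ d * n := by positivity
      nlinarith
    have h7 : n ≤ R.card * L' := by exact_mod_cast h5.trans h4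
    refine h7.trans ?_
    rw [mul_comm]
    refine Nat.mul_le_mul_right _ ?_
    nlinarith


/-! ### A Chernoff bound and separating tests. -/

section chernoff

variable {ι κ : Type*} [Fintype ι] [DecidableEq ι] [DecidableEq κ] {p : ℝ}

/-- The exponential moment method with parameter `η / 2`: since `e ^ y ≤ 1 + y + y ^ 2` for `|y| ≤
1`, each factor is at most `1 - η ^ 2 / 2 + η ^ 2 / 4`. -/
theorem bexp_indicator_le_exp (h0 : 0 ≤ p) (h1 : p ≤ 1) (R : Finset κ)
    {u : κ → (ι → Bool) → ℝ} {B : κ → Finset ι} (hu : ∀ j ∈ R, DependsOn (u j) (B j : Set ι))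
    (hB : ∀ j ∈ R, ∀ k ∈ R, j ≠ k → Disjoint (B j) (B k)) (habs : ∀ j ∈ R, ∀ x, |u j x| ≤ 1)
    {η : ℝ} (hη0 : 0 ≤ η) (hη1 : η ≤ 1) (hmean : ∀ j ∈ R, bexp p (u j) ≤ -η) :
    bexp p (fun x => if 0 ≤ ∑ j ∈ R, u j x then (1 : ℝ) else 0)
      ≤ Real.exp (-(R.card * (η ^ 2 / 4))) := by
  have step : bexp p (fun x => if 0 ≤ ∑ j ∈ R, u j x then (1 : ℝ) else 0)
      ≤ bexp p (fun x => ∏ j ∈ R, Real.exp (η / 2 * u j x)) := by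
    refine bexp_mono h0 h1 fun x => ?_
    rw [← Real.exp_sum, ← Finset.mul_sum]
    split_ifs with h
    · exact Real.one_le_exp (by positivity)
    · positivity
  refine step.trans ?_
  rw [bexp_prod_of_disjoint R (B := B)
    (fun j hj x y hxy => by simp only [hu j hj hxy]) hB]
  have e : Real.exp (-(R.card * (η ^ 2 / 4))) = ∏ _j ∈ R, Real.exp (-(η ^ 2 / 4)) := by
    rw [Finset.prod_const, ← Real.exp_nat_mul]; ring_nf
  rw [e]
  refine Finset.prod_le_prod (fun j _ => bexp_nonneg h0 h1 fun x => (Real.exp_pos _).le)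
    fun j hj => ?_
  have h2 : bexp p (fun x => Real.exp (η / 2 * u j x))
      ≤ bexp p (fun x => η / 2 * u j x + (1 + η ^ 2 / 4)) := by
    refine bexp_mono h0 h1 fun x => ?_
    have hle : |η / 2 * u j x| ≤ 1 := by
      rw [abs_mul, abs_of_nonneg (by positivity)]
      have := habs j hj x
      have := abs_nonneg (u j x)
      nlinarith
    have h3 := (abs_le.1 (Real.abs_exp_sub_one_sub_id_le hle)).2
    have h4 : (η / 2 * u j x) ^ 2 ≤ η ^ 2 / 4 := by
      have : u j x ^ 2 ≤ 1 := (sq_le_one_iff_abs_le_one _).2 (habs j hj x)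
      have := sq_nonneg η
      nlinarith
    linarith
  refine h2.trans ?_
  rw [bexp_add, bexp_mul_left, bexp_const]
  have h5 := hmean j hj
  have h6 := Real.add_one_le_exp (-(η ^ 2 / 4))
  nlinarith

/-- The indicator function of a Boolean-valued event. -/
def ind {α : Type*} (A : α → Bool) (x : α) : ℝ := if A x then 1 else 0

theorem ind_nonneg {α : Type*} (A : α → Bool) (x : α) : 0 ≤ ind A x := by
  unfold ind; split_ifs <;> norm_num

theorem ind_le_one {α : Type*} (A : α → Bool) (x : α) : ind A x ≤ 1 := by
  unfold ind; split_ifs <;> norm_num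

/-- If the outputs in disjoint, independent neighbourhoods `N j` do not have the `γ`-biased law,
then one test separates the outputs from all product distributions with bias close to `γ`. -/
theorem exists_separating_test {m n t : ℕ} {h : (Fin m → Bool) → (Fin n → Bool)} {γ ε : ℝ}
    (hγ0 : 0 ≤ γ) (hγ1 : γ ≤ 1) (hε : 0 ≤ ε)
    (R : Finset (Fin n)) {N : Fin n → Finset (Fin n)} {B : Fin n → Finset (Fin m)}
    (hN : ∀ j ∈ R, ∀ k ∈ R, j ≠ k → Disjoint (N j) (N k))
    (hB : ∀ j ∈ R, ∀ k ∈ R, j ≠ k → Disjoint (B j) (B k))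
    (hNB : ∀ j ∈ R, ∀ k ∈ N j, DependsOn (fun x => h x k) (B j : Set (Fin m)))
    (hNt : ∀ j ∈ R, (N j).card ≤ t)
    (hA : ∀ j ∈ R, ∃ A : (Fin n → Bool) → Bool, DependsOn A (N j : Set (Fin n)) ∧
      bexp γ (ind A) + ε ≤ bexp (1 / 2) (fun x => ind A (h x))) :
    ∃ T : Finset (Fin n → Bool),
      bexp (1 / 2) (fun x => if h x ∈ T then (0 : ℝ) else 1)
        ≤ Real.exp (-(R.card * (ε ^ 2 / 64))) ∧
      ∀ p, 0 ≤ p → p ≤ 1 → t * |p - γ| ≤ ε / 4 →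
        bexp p (fun y => if y ∈ T then (1 : ℝ) else 0)
          ≤ Real.exp (-(R.card * (ε ^ 2 / 64))) := by
  classical
  choose! A hAdep hAε using hA
  have hq0 : ∀ j ∈ R, 0 ≤ bexp γ (ind (A j)) := fun j _ =>
    bexp_nonneg hγ0 hγ1 fun y => ind_nonneg _ _
  have hq1 : ∀ j ∈ R, bexp γ (ind (A j)) + ε ≤ 1 := fun j hj =>
    (hAε j hj).trans (bexp_le_one (by norm_num) (by norm_num) fun x => ind_le_one _ _)
  have hind : ∀ j ∈ R, DependsOn (ind (A j)) (N j : Set (Fin n)) := fun j hj x y hxy => by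
    simp only [ind, hAdep j hj hxy]
  -- The threshold exceeds the mean under bias `γ` by `ε / 2` per event. The outputs of `h` exceed
  -- it by another `ε / 2` on average, while a bias `p` near `γ` stays `ε / 4` below it.
  let T : Finset (Fin n → Bool) :=
    univ.filter fun y => 0 ≤ ∑ j ∈ R, (ind (A j) y - (bexp γ (ind (A j)) + ε / 2))
  by_cases hRe : R = ∅
  · subst hRe
    refine ⟨∅, ?_, ?_⟩ <;> simp [bexp_const]
  obtain ⟨j₀, hj₀⟩ := Finset.nonempty_iff_ne_empty.2 hRe
  have hε1 : ε ≤ 1 := by linarith [hq0 j₀ hj₀, hq1 j₀ hj₀]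
  refine ⟨T, ?_, fun p hp0 hp1 hpγ => ?_⟩
  · have h1 := bexp_indicator_le_exp (p := 1 / 2) (by norm_num) (by norm_num) R
      (u := fun j x => bexp γ (ind (A j)) + ε / 2 - ind (A j) (h x)) (B := B)
      (fun j hj x y hxy => by
        have : ind (A j) (h x) = ind (A j) (h y) :=
          hind j hj fun k hk => hNB j hj k (Finset.mem_coe.1 hk) hxy
        simp only [this])
      hB
      (fun j hj x => by
        have := hq0 j hj; have := hq1 j hj
        have := ind_nonneg (A j) (h x); have := ind_le_one (A j) (h x)
        exact abs_le.2 ⟨by linarith, by linarith⟩)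
      (η := ε / 2) (by linarith) (by linarith)
      (fun j hj => by
        rw [bexp_sub, bexp_const]
        linarith [hAε j hj])
    refine (le_trans (bexp_mono (by norm_num) (by norm_num) fun x => ?_) h1).trans ?_
    · by_cases hx : h x ∈ T
      · simp only [hx, if_true]
        split_ifs <;> norm_num
      · rw [if_neg hx, if_pos]
        simp only [T, mem_filter, mem_univ, true_and, not_le] at hx
        rw [← neg_nonpos, ← Finset.sum_neg_distrib]
        simpa using hx.le
    · refine Real.exp_le_exp.2 (neg_le_neg (mul_le_mul_of_nonneg_left ?_ (by positivity)))
      nlinarith [sq_nonneg ε]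
  · have h1 := bexp_indicator_le_exp (p := p) hp0 hp1 R
      (u := fun j y => ind (A j) y - (bexp γ (ind (A j)) + ε / 2)) (B := N)
      (fun j hj x y hxy => by simp only [hind j hj hxy])
      hN
      (fun j hj x => by
        have := hq0 j hj; have := hq1 j hj
        have := ind_nonneg (A j) x; have := ind_le_one (A j) x
        exact abs_le.2 ⟨by linarith, by linarith⟩)
      (η := ε / 4) (by linarith) (by linarith)
      (fun j hj => by
        have h2 := abs_bexp_sub_bexp_le hp0 hp1 hγ0 hγ1 (N j) (hind j hj) (ind_nonneg _)
          (ind_le_one _)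
        have h3 : ((N j).card : ℝ) * |p - γ| ≤ t * |p - γ| :=
          mul_le_mul_of_nonneg_right (by exact_mod_cast hNt j hj) (abs_nonneg _)
        have h4 := (abs_le.1 h2).2
        rw [bexp_sub, bexp_const]
        linarith)
    simp only [T, mem_filter, mem_univ, true_and]
    refine h1.trans_eq ?_
    congr 2
    ring

end chernoff

/-! ### Comparing symmetric distributions with product distributions. -/

section slices

open Nat in
-- The binomial distribution with mean `w` has its mode at `w`. After cancelling `n !`, the claim
-- compares quotients of factorials with powers: `b ! / a ! ≤ b ^ (b - a)` and `c ! / e ! ≥ e ^ (c -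
-- e)`.
theorem choose_mul_pow_le {n w k : ℕ} (hw : w ≤ n) (hk : k ≤ n) :
    n.choose k * (w ^ k * (n - w) ^ (n - k)) ≤ n.choose w * (w ^ w * (n - w) ^ (n - w)) := by
  have key : ∀ a b c e : ℕ, a ≤ b → e ≤ c → c - e = b - a →
      b ! * e ! * (b ^ a * e ^ c) ≤ a ! * c ! * (b ^ b * e ^ e) := by
    intro a b c e hab hec heq
    have h1 : b ! ≤ a ! * b ^ (b - a) := by
      rw [← Nat.factorial_mul_descFactorial (Nat.sub_le b a), Nat.sub_sub_self hab]
      exact Nat.mul_le_mul_left _ (Nat.descFactorial_le_pow _ _)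
    have h2 : e ! * e ^ (b - a) ≤ c ! := by
      rw [← heq]; exact Nat.factorial_mul_pow_sub_le_factorial hec
    have e1 : b ^ b = b ^ (b - a) * b ^ a := by rw [← pow_add]; congr 1; omega
    have e2 : e ^ c = e ^ (b - a) * e ^ e := by rw [← pow_add]; congr 1; omega
    calc b ! * e ! * (b ^ a * e ^ c) = b ! * (e ! * e ^ (b - a)) * (b ^ a * e ^ e) := by
          rw [e2]; ring
      _ ≤ (a ! * b ^ (b - a)) * c ! * (b ^ a * e ^ e) := by gcongr
      _ = _ := by rw [e1]; ring
  have hmain : w ! * (n - w) ! * (w ^ k * (n - w) ^ (n - k))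
      ≤ k ! * (n - k) ! * (w ^ w * (n - w) ^ (n - w)) := by
    rcases le_total k w with hkw | hkw
    · exact key k w (n - k) (n - w) hkw (by omega) (by omega)
    · have := key (n - k) (n - w) k w (by omega) hkw (by omega)
      calc _ = (n - w)! * w ! * ((n - w) ^ (n - k) * w ^ k) := by ring
        _ ≤ _ := this
        _ = _ := by ring
  have hpos : 0 < w ! * (n - w) ! * (k ! * (n - k) !) := by positivity
  refine Nat.le_of_mul_le_mul_left ?_ hpos
  have c1 := Nat.choose_mul_factorial_mul_factorial hw
  have c2 := Nat.choose_mul_factorial_mul_factorial hk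
  calc _ = (n.choose k * k ! * (n - k)!) * (w ! * (n - w) ! * (w ^ k * (n - w) ^ (n - k))) := by
        ring
    _ ≤ (n.choose k * k ! * (n - k)!) * (k ! * (n - k) ! * (w ^ w * (n - w) ^ (n - w))) := by
        gcongr
    _ = (n.choose w * w ! * (n - w)!) * (k ! * (n - k) ! * (w ^ w * (n - w) ^ (n - w))) := by
        rw [c1, c2]
    _ = _ := by ring

/-- The binomial distribution with mean `w` has probability at least `1 / (n + 1)` at `w`. -/
theorem one_le_succ_mul_choose_mul {n w : ℕ} (hn : 0 < n) (hw : w ≤ n) :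
    1 ≤ (n + 1 : ℝ) * (n.choose w * ((w / n : ℝ) ^ w * (1 - w / n : ℝ) ^ (n - w))) := by
  have hn' : (0 : ℝ) < n := by exact_mod_cast hn
  have e : (1 - w / n : ℝ) = ((n - w : ℕ) : ℝ) / n := by
    rw [Nat.cast_sub hw]; field_simp
  have hterm : ∀ k ≤ n, (w / n : ℝ) ^ k * (1 - w / n : ℝ) ^ (n - k)
      = ((w ^ k * (n - w) ^ (n - k) : ℕ) : ℝ) / (n : ℝ) ^ n := by
    intro k hk
    rw [e, div_pow, div_pow, div_mul_div_comm, ← pow_add, Nat.add_sub_cancel' hk]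
    push_cast
    rfl
  have hsum := add_pow (w / n : ℝ) (1 - w / n) n
  rw [add_sub_cancel, one_pow] at hsum
  have : ∑ k ∈ range (n + 1), (w / n : ℝ) ^ k * (1 - w / n : ℝ) ^ (n - k) * (n.choose k : ℝ)
      ≤ ∑ _k ∈ range (n + 1), (n.choose w * ((w / n : ℝ) ^ w * (1 - w / n : ℝ) ^ (n - w))) := by
    refine Finset.sum_le_sum fun k hk => ?_
    have hk' : k ≤ n := Nat.lt_succ_iff.1 (mem_range.1 hk)
    rw [hterm k hk', hterm w hw, div_mul_eq_mul_div, mul_div_assoc']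
    refine div_le_div_of_nonneg_right ?_ (by positivity)
    have := choose_mul_pow_le hw hk'
    rw [mul_comm] at this
    exact_mod_cast this
  refine (hsum.trans_le this).trans_eq ?_
  simp

theorem bwt_eq_pow {n : ℕ} (p : ℝ) (x : Fin n → Bool) :
    bwt p x = p ^ hammingWeight x * (1 - p) ^ (n - hammingWeight x) := by
  unfold bwt hammingWeight
  rw [Finset.prod_ite, Finset.prod_const, Finset.prod_const]
  have := Finset.card_filter_add_card_filter_not (s := (univ : Finset (Fin n)))
    (fun i => x i = true)
  rw [Finset.card_univ, Fintype.card_fin] at this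
  congr 2
  omega

theorem hammingWeight_le {n : ℕ} (x : Fin n → Bool) : hammingWeight x ≤ n :=
  (Finset.card_filter_le _ _).trans_eq (by simp)

theorem card_hammingWeight_eq (n w : ℕ) :
    (univ.filter fun x : Fin n → Bool => hammingWeight x = w).card = n.choose w := by
  have : (univ.powersetCard w : Finset (Finset (Fin n))).card = n.choose w := by simp
  rw [← this]
  refine Finset.card_bij (fun x _ => univ.filter fun i => x i = true) ?_ ?_ ?_
  · intro x hx
    exact Finset.mem_powersetCard.2 ⟨Finset.subset_univ _, (mem_filter.1 hx).2⟩
  · intro x _ y _ hxy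
    funext i
    have := Finset.ext_iff.1 hxy i
    simp only [mem_filter, mem_univ, true_and] at this
    exact Bool.eq_iff_iff.2 this
  · intro s hs
    refine ⟨fun i => decide (i ∈ s), ?_, ?_⟩
    · refine mem_filter.2 ⟨mem_univ _, ?_⟩
      simpa [hammingWeight] using hs
    · ext i; simp

/-- A bijection between the sets of ones extends to a permutation of the coordinates. -/
theorem IsSymmetricDist.eq_of_hammingWeight_eq {n : ℕ} {D : PMF (Fin n → Bool)}
    (hD : IsSymmetricDist D) {x y : Fin n → Bool} (h : hammingWeight x = hammingWeight y) :
    D x = D y := by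
  have hc : Fintype.card {i // y i = true} = Fintype.card {i // x i = true} := by
    rw [Fintype.card_subtype, Fintype.card_subtype]; exact h.symm
  let e := Fintype.equivOfCardEq hc
  rw [← hD e.extendSubtype x]
  congr 1
  funext i
  by_cases hi : y i = true
  · simpa [hi] using e.extendSubtype_mem i hi
  · have := e.extendSubtype_not_mem i hi
    simp only [Function.comp_apply]
    rw [Bool.not_eq_true] at hi this
    rw [hi, this]

theorem sum_toReal_pmf {α : Type*} [Fintype α] (P : PMF α) : ∑ x, (P x).toReal = 1 := by
  rw [← ENNReal.toReal_sum fun x _ => P.apply_ne_top x, ← tsum_fintype (L := .unconditional α),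
    P.tsum_coe, ENNReal.toReal_one]

theorem sum_sub_sum_le_tvDist {α : Type*} [Fintype α] [DecidableEq α] (P Q : PMF α)
    (T : Finset α) : ∑ x ∈ T, (P x).toReal - ∑ x ∈ T, (Q x).toReal ≤ tvDist P Q := by
  have h0 : ∑ x, ((P x).toReal - (Q x).toReal) = 0 := by
    rw [Finset.sum_sub_distrib, sum_toReal_pmf, sum_toReal_pmf, sub_self]
  have h1 := Finset.sum_add_sum_compl T fun x => (P x).toReal - (Q x).toReal
  have h2 := Finset.sum_add_sum_compl T fun x => |(P x).toReal - (Q x).toReal|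
  have h3 : ∑ x ∈ T, ((P x).toReal - (Q x).toReal) ≤ ∑ x ∈ T, |(P x).toReal - (Q x).toReal| :=
    Finset.sum_le_sum fun x _ => le_abs_self _
  have h4 : -∑ x ∈ Tᶜ, ((P x).toReal - (Q x).toReal) ≤ ∑ x ∈ Tᶜ, |(P x).toReal - (Q x).toReal| := by
    rw [← Finset.sum_neg_distrib]
    exact Finset.sum_le_sum fun x _ => neg_le_abs _
  rw [← Finset.sum_sub_distrib]
  unfold tvDist
  linarith

/-- A symmetric distribution is dominated, up to a factor `n + 1`, by product distributions whose
means are its weights. -/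
theorem IsSymmetricDist.sum_le {n : ℕ} (hn : 0 < n) {D : PMF (Fin n → Bool)}
    (hD : IsSymmetricDist D) {c r M : ℝ} (hw : HasWeightsWithin D c r) (T : Finset (Fin n → Bool))
    (hM : ∀ w : ℕ, w ≤ n → |(w : ℝ) - c| ≤ r →
      bexp (w / n : ℝ) (fun y => if y ∈ T then (1 : ℝ) else 0) ≤ M) :
    ∑ y ∈ T, (D y).toReal ≤ (n + 1) * M := by
  classical
  -- On the slice of weight `w` both `D` and the product distribution of bias `w / n` are constant,
  -- and the latter gives the slice mass at least `1 / (n + 1)`.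
  have hlevel : ∀ w ∈ range (n + 1),
      ∑ y ∈ T with hammingWeight y = w, (D y).toReal
        ≤ (n + 1) * M * ∑ y with hammingWeight y = w, (D y).toReal := by
    intro w hwn
    have hwn' : w ≤ n := Nat.lt_succ_iff.1 (mem_range.1 hwn)
    by_cases hz : ∀ y : Fin n → Bool, hammingWeight y = w → D y = 0
    · rw [Finset.sum_eq_zero fun y hy => by rw [hz y (mem_filter.1 hy).2, ENNReal.toReal_zero],
        Finset.sum_eq_zero fun y hy => by rw [hz y (mem_filter.1 hy).2, ENNReal.toReal_zero],
        mul_zero]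
    push Not at hz
    obtain ⟨y₀, hy₀, hDy₀⟩ := hz
    have hconst : ∀ y : Fin n → Bool, hammingWeight y = w → (D y).toReal = (D y₀).toReal :=
      fun y hy => by rw [hD.eq_of_hammingWeight_eq (hy.trans hy₀.symm)]
    rw [Finset.sum_congr rfl fun y hy => hconst y (mem_filter.1 hy).2,
      Finset.sum_congr rfl fun y hy => hconst y (mem_filter.1 hy).2, Finset.sum_const,
      Finset.sum_const, card_hammingWeight_eq, nsmul_eq_mul, nsmul_eq_mul]
    have hb := hM w hwn' (hy₀ ▸ hw y₀ ((PMF.mem_support_iff _ _).2 hDy₀))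
    have hn' : (0 : ℝ) < n := by exact_mod_cast hn
    have hp0 : (0 : ℝ) ≤ w / n := by positivity
    have hp1 : (w / n : ℝ) ≤ 1 := (div_le_one hn').2 (by exact_mod_cast hwn')
    set p : ℝ := w / n with hp
    have h1 : ((T.filter fun y => hammingWeight y = w).card : ℝ) * (p ^ w * (1 - p) ^ (n - w))
        ≤ M := by
      refine le_trans ?_ hb
      have : ((T.filter fun y => hammingWeight y = w).card : ℝ) * (p ^ w * (1 - p) ^ (n - w))
          = ∑ y ∈ T.filter (fun y => hammingWeight y = w),
            bwt p y • (if y ∈ T then (1 : ℝ) else 0) := by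
        rw [← nsmul_eq_mul, ← Finset.sum_const]
        refine Finset.sum_congr rfl fun y hy => ?_
        rw [mem_filter] at hy
        rw [if_pos hy.1, bwt_eq_pow, hy.2, smul_eq_mul, mul_one]
      rw [this]
      refine Finset.sum_le_sum_of_subset_of_nonneg (Finset.subset_univ _) fun y _ _ => ?_
      refine mul_nonneg (bwt_nonneg hp0 hp1 y) ?_
      split_ifs <;> norm_num
    have h2 := one_le_succ_mul_choose_mul hn hwn'
    rw [← hp] at h2
    set Z := p ^ w * (1 - p) ^ (n - w)
    set k : ℝ := ((T.filter fun y => hammingWeight y = w).card : ℝ)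
    have h3 : k ≤ (n + 1) * M * n.choose w := by
      have hk : 0 ≤ k := Nat.cast_nonneg _
      calc k ≤ k * ((n + 1 : ℝ) * (n.choose w * Z)) := le_mul_of_one_le_right hk h2
        _ = (k * Z) * ((n + 1) * n.choose w) := by ring
        _ ≤ M * ((n + 1) * n.choose w) := mul_le_mul_of_nonneg_right h1 (by positivity)
        _ = _ := by ring
    calc k * (D y₀).toReal ≤ (n + 1) * M * n.choose w * (D y₀).toReal :=
          mul_le_mul_of_nonneg_right h3 ENNReal.toReal_nonneg
      _ = _ := by ring
  have hmaps : ∀ s : Finset (Fin n → Bool), ∀ y ∈ s, hammingWeight y ∈ range (n + 1) :=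
    fun s y _ => mem_range.2 (Nat.lt_succ_of_le (hammingWeight_le y))
  rw [← Finset.sum_fiberwise_of_maps_to (hmaps T)]
  refine (Finset.sum_le_sum hlevel).trans_eq ?_
  rw [← Finset.mul_sum, Finset.sum_fiberwise_of_maps_to (hmaps univ), sum_toReal_pmf, mul_one]

end slices


/-! ### Variances of unimodular functions. -/

section variance

variable {ι : Type*} [Fintype ι] [DecidableEq ι] {p : ℝ}

theorem bexp_norm_sub_sq (F : (ι → Bool) → ℂ) (a : ℂ) :
    bexp p (fun x => ‖F x - a‖ ^ 2)
      = bexp p (fun x => ‖F x‖ ^ 2) - ‖bexp p F‖ ^ 2 + ‖bexp p F - a‖ ^ 2 := by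
  have hre : bexp p (fun x => (F x).re) = (bexp p F).re :=
    bexp_map (p := p) Complex.reLm F
  have him : bexp p (fun x => (F x).im) = (bexp p F).im :=
    bexp_map (p := p) Complex.imLm F
  have e : ∀ z : ℂ, ‖z - a‖ ^ 2 = ‖z‖ ^ 2 - (2 * a.re * z.re + 2 * a.im * z.im) + ‖a‖ ^ 2 := by
    intro z
    simp only [Complex.sq_norm, Complex.normSq_apply, Complex.sub_re, Complex.sub_im]
    ring
  simp only [e]
  rw [bexp_add, bexp_sub, bexp_add, bexp_mul_left, bexp_mul_left, bexp_const, hre, him]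
  ring

/-- For `‖F‖ = 1` both sides are variances. Squaring is 2-Lipschitz on the unit disc, so the mean
square distance of `F ^ 2` from the square of the mean of `F` is at most four times the variance of
`F`. -/
theorem one_sub_norm_sq_bexp_sq_le (h0 : 0 ≤ p) (h1 : p ≤ 1) {F : (ι → Bool) → ℂ}
    (hF : ∀ x, ‖F x‖ = 1) :
    1 - ‖bexp p (fun x => F x ^ 2)‖ ^ 2 ≤ 4 * (1 - ‖bexp p F‖ ^ 2) := by
  have v1 := bexp_norm_sub_sq (p := p) (fun x => F x ^ 2) (bexp p F ^ 2)
  have v2 := bexp_norm_sub_sq (p := p) F (bexp p F)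
  simp only [norm_pow, hF, one_pow, bexp_const, sub_self, norm_zero, ne_eq, OfNat.ofNat_ne_zero,
    not_false_eq_true, zero_pow, add_zero] at v1 v2
  have hg : ‖bexp p F‖ ≤ 1 := by
    refine (norm_bexp_le h0 h1 F).trans ?_
    simp [hF, bexp_const]
  have h3 : bexp p (fun x => ‖F x ^ 2 - bexp p F ^ 2‖ ^ 2)
      ≤ bexp p (fun x => 4 * ‖F x - bexp p F‖ ^ 2) := by
    refine bexp_mono h0 h1 fun x => ?_
    rw [sq_sub_sq, norm_mul, mul_pow]
    refine mul_le_mul_of_nonneg_right ?_ (sq_nonneg _)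
    have h4 : ‖F x + bexp p F‖ ≤ 2 := (norm_add_le _ _).trans (by linarith [hF x])
    nlinarith [norm_nonneg (F x + bexp p F)]
  rw [bexp_mul_left, v2] at h3
  have := sq_nonneg ‖bexp p (fun x => F x ^ 2) - bexp p F ^ 2‖
  linarith

end variance

/-! ### Conditional randomness of the weight in a neighbourhood with the product law. -/

section localLaw

/-- The character `ω ^ (number of ones of y in N)`. -/
def chr {n : ℕ} (ω : ℂ) (N : Finset (Fin n)) (y : Fin n → Bool) : ℂ :=
  ∏ k ∈ N, if y k then ω else 1

variable {m n : ℕ} {ω : ℂ}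

theorem chr_univ (y : Fin n → Bool) : chr ω univ y = ω ^ hammingWeight y := by
  unfold chr hammingWeight
  rw [Finset.prod_ite, Finset.prod_const, Finset.prod_const_one, mul_one]

theorem norm_chr (hω : ‖ω‖ = 1) (N : Finset (Fin n)) (y : Fin n → Bool) : ‖chr ω N y‖ = 1 := by
  unfold chr
  rw [norm_prod]
  refine Finset.prod_eq_one fun k _ => ?_
  split_ifs <;> simp [hω]

theorem chr_sq (N : Finset (Fin n)) (y : Fin n → Bool) : chr ω N y ^ 2 = chr (ω ^ 2) N y := by
  unfold chr
  rw [← Finset.prod_pow]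
  refine Finset.prod_congr rfl fun k _ => ?_
  split_ifs <;> simp

theorem dependsOn_chr (N : Finset (Fin n)) : DependsOn (chr ω N) (N : Set (Fin n)) := by
  intro x y hxy
  refine Finset.prod_congr rfl fun k hk => ?_
  rw [hxy k (Finset.mem_coe.2 hk)]

/-- The outputs of `h` in `N` are independent with bias `γ`. -/
def IsProductLaw (h : (Fin m → Bool) → (Fin n → Bool)) (γ : ℝ) (N : Finset (Fin n)) : Prop :=
  ∀ A : (Fin n → Bool) → Bool, DependsOn A (N : Set (Fin n)) →
    bexp (1 / 2) (fun x => ind A (h x)) = bexp γ (ind A)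

/-- Decomposing `G` into its level sets passes from events to complex-valued functions. -/
theorem IsProductLaw.bexp_eq {h : (Fin m → Bool) → (Fin n → Bool)} {γ : ℝ} {N : Finset (Fin n)}
    (hh : IsProductLaw h γ N) {G : (Fin n → Bool) → ℂ} (hG : DependsOn G (N : Set (Fin n))) :
    bexp (1 / 2) (fun x => G (h x)) = bexp γ G := by
  classical
  have e : ∀ y, G y = ∑ v ∈ univ.image G,
      LinearMap.toSpanSingleton ℝ ℂ v (ind (fun z => decide (G z = v)) y) := by
    intro y
    simp only [ind, LinearMap.toSpanSingleton_apply, decide_eq_true_eq, ite_smul, one_smul,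
      zero_smul]
    rw [Finset.sum_ite_eq, if_pos (mem_image_of_mem G (mem_univ y))]
  rw [show G = fun y => ∑ v ∈ univ.image G,
      LinearMap.toSpanSingleton ℝ ℂ v (ind (fun z => decide (G z = v)) y) from funext e]
  rw [bexp_sum, bexp_sum]
  refine Finset.sum_congr rfl fun v _ => ?_
  rw [bexp_map, bexp_map, hh]
  intro x y hxy
  simp only [hG hxy]

/-- The expectation factorises over coordinates: `i` contributes `γ * (1 - γ) * (ω - 1)` and every
other coordinate `1 - γ + γ * ω`. -/
theorem bexp_chr_mul_sub {γ : ℝ} {N : Finset (Fin n)} {i : Fin n} (hi : i ∈ N) :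
    bexp γ (fun y : Fin n → Bool => chr ω N y * ((ind (fun z => z i) y : ℝ) - γ : ℂ))
      = γ * (1 - γ) * (ω - 1) * (1 - γ + γ * ω) ^ (N.card - 1) := by
  have e : ∀ y : Fin n → Bool, chr ω N y * ((ind (fun z => z i) y : ℝ) - γ : ℂ)
      = ∏ k ∈ N, (if y k then ω else 1) *
        if k = i then (if y k then 1 else 0) - (γ : ℂ) else 1 := by
    intro y
    rw [Finset.prod_mul_distrib, Finset.prod_ite_eq' N i, if_pos hi]
    simp only [chr, ind, apply_ite ((↑) : ℝ → ℂ), Complex.ofReal_one, Complex.ofReal_zero]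
  rw [funext e, bexp_prod_coord N (fun k b => (if b then ω else 1) *
        if k = i then (if b then 1 else 0) - (γ : ℂ) else 1), ← Finset.mul_prod_erase N _ hi]
  have : ∏ k ∈ N.erase i, (γ • ((if true = true then ω else 1) *
        if k = i then (if true = true then 1 else 0) - (γ : ℂ) else 1) +
        (1 - γ) • ((if false = true then ω else 1) *
        if k = i then (if false = true then 1 else 0) - (γ : ℂ) else 1))
      = ∏ _k ∈ N.erase i, (1 - γ + γ * ω) := by
    refine Finset.prod_congr rfl fun k hk => ?_
    simp only [Finset.ne_of_mem_erase hk]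
    simp
    ring
  rw [this, Finset.prod_const, Finset.card_erase_of_mem hi]
  simp only [if_true, Bool.false_eq_true, if_false, Complex.real_smul]
  push_cast
  ring

/-- The conditional expectation of the character `chr ω N` of the output, given the inputs
outside `I`. -/
def condChr (h : (Fin m → Bool) → (Fin n → Bool)) (ω : ℂ) (N : Finset (Fin n))
    (I : Finset (Fin m)) (x : Fin m → Bool) : ℂ :=
  bexp (1 / 2) fun y => chr ω N (h (I.piecewise y x))

/-- The right side is the mean conditional variance of the character given the inputs outside `I`.
The centred output `u` reads only `I`, so it is uncorrelated with the conditional expectation, and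
its correlation `c` with the character comes entirely from the fluctuation `chr - condChr`. As `|u|
≤ 1`, Cauchy–Schwarz bounds `‖c‖ ^ 2` by that variance, and `c` is known from the product law. -/
theorem IsProductLaw.le_one_sub_bexp {h : (Fin m → Bool) → (Fin n → Bool)} {γ : ℝ}
    {N : Finset (Fin n)} (hh : IsProductLaw h γ N) (hω : ‖ω‖ = 1) {i : Fin n} (hi : i ∈ N)
    {I : Finset (Fin m)} (hI : DependsOn (fun x => h x i) (I : Set (Fin m)))
    (hγ0 : 0 ≤ γ) (hγ1 : γ ≤ 1) :
    (γ * (1 - γ)) ^ 2 * ‖ω - 1‖ ^ 2 * (‖1 - γ + γ * ω‖ ^ 2) ^ (N.card - 1)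
      ≤ 1 - bexp (1 / 2) (fun x => ‖condChr h ω N I x‖ ^ 2) := by
  have hhalf0 : (0 : ℝ) ≤ 1 / 2 := by norm_num
  have hhalf1 : (1 / 2 : ℝ) ≤ 1 := by norm_num
  set c : ℂ := γ * (1 - γ) * (ω - 1) * (1 - γ + γ * ω) ^ (N.card - 1) with hc
  set u : (Fin n → Bool) → ℂ := fun y => (ind (fun z => z i) y : ℝ) - γ with hu
  have hudep : DependsOn u ({i} : Set (Fin n)) := fun x y hxy => by
    simp only [hu, ind, hxy i rfl]
  have hunorm : ∀ y, ‖u y‖ ≤ 1 := by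
    intro y
    simp only [hu]
    rw [← Complex.ofReal_sub, Complex.norm_real, Real.norm_eq_abs]
    have := ind_nonneg (fun z : Fin n → Bool => z i) y
    have := ind_le_one (fun z : Fin n → Bool => z i) y
    exact abs_le.2 ⟨by linarith, by linarith⟩
  have h1 : bexp (1 / 2) (fun x => chr ω N (h x) * u (h x)) = c := by
    rw [hh.bexp_eq (G := fun y => chr ω N y * u y), hc, ← bexp_chr_mul_sub hi]
    intro x y hxy
    have e : u x = u y := hudep fun k hk => hxy k (by rw [hk]; exact hi)
    simp only [e, dependsOn_chr N hxy]
  have h0 : bexp (1 / 2) (fun x => u (h x)) = 0 := by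
    rw [hh.bexp_eq (G := u) (fun x y hxy => hudep fun k hk => hxy k (by rw [hk]; exact hi))]
    have := bexp_chr_mul_sub (ω := 1) (γ := γ) hi
    simpa [chr] using this
  have hIi : ∀ x y, u (h (I.piecewise y x)) = u (h y) := fun x y => hudep fun k hk => by
    rw [Set.mem_singleton_iff] at hk
    rw [hk]
    exact piecewise_eq_of_dependsOn hI y x
  have h2 : bexp (1 / 2) (fun x => bexp (1 / 2) fun y =>
      (chr ω N (h (I.piecewise y x)) - condChr h ω N I x) * u (h y)) = c := by
    rw [← h1, bexp_resample I fun x => chr ω N (h x) * u (h x)]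
    congr 1
    funext x
    simp only [hIi, sub_mul]
    rw [bexp_sub, bexp_mul_left, h0, mul_zero, sub_zero]
  have h3 : ‖c‖ ≤ bexp (1 / 2) fun x => bexp (1 / 2) fun y =>
      ‖chr ω N (h (I.piecewise y x)) - condChr h ω N I x‖ := by
    rw [← h2]
    refine (norm_bexp_le hhalf0 hhalf1 _).trans (bexp_mono hhalf0 hhalf1 fun x => ?_)
    refine (norm_bexp_le hhalf0 hhalf1 _).trans (bexp_mono hhalf0 hhalf1 fun y => ?_)
    rw [norm_mul]
    exact mul_le_of_le_one_right (norm_nonneg _) (hunorm _)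
  have h4 : ‖c‖ ^ 2 ≤ bexp (1 / 2) fun x => bexp (1 / 2) fun y =>
      ‖chr ω N (h (I.piecewise y x)) - condChr h ω N I x‖ ^ 2 := by
    refine (pow_le_pow_left₀ (norm_nonneg _) h3 2).trans
      ((sq_bexp_le hhalf0 hhalf1 _).trans (bexp_mono hhalf0 hhalf1 fun x => ?_))
    exact sq_bexp_le hhalf0 hhalf1 _
  have h5 : ∀ x, bexp (1 / 2) (fun y =>
      ‖chr ω N (h (I.piecewise y x)) - condChr h ω N I x‖ ^ 2)
      = 1 - ‖condChr h ω N I x‖ ^ 2 := by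
    intro x
    rw [bexp_norm_sub_sq (fun y => chr ω N (h (I.piecewise y x)))]
    simp only [norm_chr hω, one_pow, bexp_const]
    simp [condChr]
  simp only [h5] at h4
  rw [bexp_sub, bexp_const] at h4
  refine le_trans (le_of_eq ?_) h4
  have hcc : c = ((γ * (1 - γ) : ℝ) : ℂ) * (ω - 1) * (1 - γ + γ * ω) ^ (N.card - 1) := by
    rw [hc]; push_cast; ring
  rw [hcc, norm_mul, norm_mul, norm_pow, Complex.norm_real, Real.norm_eq_abs,
    abs_of_nonneg (mul_nonneg hγ0 (sub_nonneg.2 hγ1))]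
  ring

theorem one_sub_bexp_condChr_sq_le {h : (Fin m → Bool) → (Fin n → Bool)} (hω : ‖ω‖ = 1)
    (N : Finset (Fin n)) (I : Finset (Fin m)) :
    1 - bexp (1 / 2) (fun x => ‖condChr h (ω ^ 2) N I x‖ ^ 2)
      ≤ 4 * (1 - bexp (1 / 2) (fun x => ‖condChr h ω N I x‖ ^ 2)) := by
  have := bexp_mono (p := 1 / 2) (by norm_num) (by norm_num) fun x =>
    one_sub_norm_sq_bexp_sq_le (p := 1 / 2) (by norm_num) (by norm_num)
      (F := fun y => chr ω N (h (I.piecewise y x))) fun y => norm_chr hω N _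
  simp only [chr_sq] at this
  rw [bexp_sub, bexp_mul_left, bexp_sub, bexp_const] at this
  exact this

theorem norm_add_one_sq_add_norm_sub_one_sq (hω : ‖ω‖ = 1) :
    ‖ω + 1‖ ^ 2 + ‖ω - 1‖ ^ 2 = 4 := by
  have := parallelogram_law_with_norm ℝ ω 1
  simp only [hω, norm_one] at this
  linarith

/-- On the unit circle the right side is smallest at `ω = -1`. -/
theorem sq_one_sub_two_mul_le (hω : ‖ω‖ = 1) {γ : ℝ} (hγ0 : 0 ≤ γ) (hγ1 : γ ≤ 1) :
    (1 - 2 * γ) ^ 2 ≤ ‖1 - γ + γ * ω‖ ^ 2 := by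
  have h1 : ω.re * ω.re + ω.im * ω.im = 1 := by
    rw [← Complex.normSq_apply, ← Complex.sq_norm, hω, one_pow]
  have h2 : -1 ≤ ω.re := by nlinarith [mul_self_nonneg ω.im]
  simp only [Complex.sq_norm, Complex.normSq_apply, Complex.add_re, Complex.sub_re, Complex.one_re,
    Complex.ofReal_re, Complex.mul_re, Complex.ofReal_im, Complex.add_im, Complex.sub_im,
    Complex.one_im, Complex.mul_im]
  have h3 : 0 ≤ γ * (1 - γ) * (1 + ω.re) :=
    mul_nonneg (mul_nonneg hγ0 (by linarith)) (by linarith)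
  have h4 : γ ^ 2 * (ω.re * ω.re + ω.im * ω.im) = γ ^ 2 := by rw [h1, mul_one]
  nlinarith

/-- Quantitative nondegeneracy of the weight in a neighbourhood with the `γ`-biased law, given the
inputs outside `I`, for `γ ≠ 1 / 2`. -/
theorem IsProductLaw.le_one_sub_bexp_of_ne {h : (Fin m → Bool) → (Fin n → Bool)} {γ : ℝ}
    {N : Finset (Fin n)} (hh : IsProductLaw h γ N) (hω : ‖ω‖ = 1) {i : Fin n} (hi : i ∈ N)
    {I : Finset (Fin m)} (hI : DependsOn (fun x => h x i) (I : Set (Fin m)))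
    (hγ0 : 0 ≤ γ) (hγ1 : γ ≤ 1) {κ : ℝ} (hκ0 : 0 ≤ κ) (hκ1 : κ ≤ 1) (hκ2 : κ ≤ γ * (1 - γ))
    (hκ3 : κ ≤ |1 - 2 * γ|) {K : ℕ} (hN : N.card ≤ K) :
    κ ^ 2 * (κ ^ 2) ^ K * ‖ω - 1‖ ^ 2
      ≤ 1 - bexp (1 / 2) (fun x => ‖condChr h ω N I x‖ ^ 2) := by
  refine le_trans ?_ (hh.le_one_sub_bexp hω hi hI hγ0 hγ1)
  have h1 : κ ^ 2 ≤ ‖1 - γ + γ * ω‖ ^ 2 := by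
    refine le_trans ?_ (sq_one_sub_two_mul_le hω hγ0 hγ1)
    rw [← sq_abs (1 - 2 * γ)]
    exact pow_le_pow_left₀ hκ0 hκ3 2
  have h2 : (κ ^ 2) ^ K ≤ (‖1 - γ + γ * ω‖ ^ 2) ^ (N.card - 1) :=
    (pow_le_pow_of_le_one (sq_nonneg _) (pow_le_one₀ hκ0 hκ1) (by omega)).trans
      (pow_le_pow_left₀ (sq_nonneg _) h1 _)
  have h3 : κ ^ 2 ≤ (γ * (1 - γ)) ^ 2 := pow_le_pow_left₀ hκ0 hκ2 2
  calc κ ^ 2 * (κ ^ 2) ^ K * ‖ω - 1‖ ^ 2 = κ ^ 2 * ‖ω - 1‖ ^ 2 * (κ ^ 2) ^ K := by ring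
    _ ≤ _ := by gcongr

/-- The same for `γ = 1 / 2`, where the weight may be constant modulo `2`. -/
theorem IsProductLaw.le_one_sub_bexp_half {h : (Fin m → Bool) → (Fin n → Bool)}
    {N : Finset (Fin n)} (hh : IsProductLaw h (1 / 2) N) (hω : ‖ω‖ = 1) {i : Fin n} (hi : i ∈ N)
    {I : Finset (Fin m)} (hI : DependsOn (fun x => h x i) (I : Set (Fin m)))
    {K : ℕ} (hN : N.card ≤ K) :
    1 / 64 * (1 / 8) ^ K * ‖ω ^ 2 - 1‖ ^ 2
      ≤ 1 - bexp (1 / 2) (fun x => ‖condChr h ω N I x‖ ^ 2) := by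
  have hω2 : ‖ω ^ 2‖ = 1 := by rw [norm_pow, hω, one_pow]
  have e : ∀ z : ℂ, ‖1 - ((1 / 2 : ℝ) : ℂ) + ((1 / 2 : ℝ) : ℂ) * z‖ ^ 2 = ‖z + 1‖ ^ 2 / 4 := by
    intro z
    have : 1 - ((1 / 2 : ℝ) : ℂ) + ((1 / 2 : ℝ) : ℂ) * z = (1 / 2) * (z + 1) := by
      push_cast; ring
    rw [this, norm_mul, mul_pow]
    norm_num
    ring
  have h1 := hh.le_one_sub_bexp hω hi hI (by norm_num) (by norm_num)
  have h2 := (hh.le_one_sub_bexp hω2 hi hI (by norm_num) (by norm_num)).trans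
    (one_sub_bexp_condChr_sq_le hω N I)
  rw [e] at h1 h2
  have p1 := norm_add_one_sq_add_norm_sub_one_sq hω
  have p2 := norm_add_one_sq_add_norm_sub_one_sq hω2
  have e2 : ‖ω ^ 2 - 1‖ ^ 2 = ‖ω - 1‖ ^ 2 * ‖ω + 1‖ ^ 2 := by
    rw [← mul_pow, ← norm_mul]; congr 2; ring
  have hpow : ∀ b : ℝ, 1 / 8 ≤ b → (1 / 8 : ℝ) ^ K ≤ b ^ (N.card - 1) := fun b hb =>
    (pow_le_pow_of_le_one (by norm_num) (by norm_num) (by omega)).trans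
      (pow_le_pow_left₀ (by norm_num) hb _)
  have q0 := sq_nonneg ‖ω - 1‖
  have s0 := sq_nonneg ‖ω + 1‖
  have r0 := sq_nonneg ‖ω ^ 2 - 1‖
  -- The direct bound `h1` degenerates at `ω = -1`. If `ω ^ 2` is close to `1`, the bound `h2`
  -- obtained from the character of `ω ^ 2` is used; otherwise `ω` stays away from `-1` and `h1`
  -- suffices.
  by_cases hr : ‖ω ^ 2 - 1‖ ^ 2 ≤ 2
  · have h3 := hpow (‖ω ^ 2 + 1‖ ^ 2 / 4) (by linarith)
    have h4 := mul_le_mul_of_nonneg_left h3 r0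
    linarith
  · have hs : 1 / 2 ≤ ‖ω + 1‖ ^ 2 := by
      by_contra! hlt
      have := mul_le_mul (by linarith : ‖ω - 1‖ ^ 2 ≤ 4) hlt.le s0 (by norm_num)
      linarith
    have h3 := hpow (‖ω + 1‖ ^ 2 / 4) (by linarith)
    have h4 := mul_le_mul_of_nonneg_left h3 q0
    have h5 : ‖ω ^ 2 - 1‖ ^ 2 ≤ ‖ω - 1‖ ^ 2 * 4 := by
      rw [e2]; exact mul_le_mul_of_nonneg_left (by linarith) q0
    have h6 := mul_le_mul_of_nonneg_right h5 (by positivity : (0 : ℝ) ≤ (1 / 8) ^ K)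
    linarith

end localLaw


/-! ### Factorisation of the characteristic function of the weight. -/

section product

variable {m n : ℕ} {ω : ℂ} {T : Fin n → Finset (Fin m)} {h : (Fin m → Bool) → (Fin n → Bool)}

theorem self_mem_nbhd {V X : Type*} [Fintype V] [DecidableEq V] [DecidableEq X]
    (T : V → Finset X) (i : V) : i ∈ nbhd T i := by simp [nbhd]

theorem subset_block (T : Fin n → Finset (Fin m)) {i k : Fin n} (hk : k ∈ nbhd T i) :
    T k ⊆ block T i := Finset.subset_biUnion_of_mem T hk

/-- The inputs of a common output would lie in both blocks, so it would have none; but an output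
without inputs belongs to no neighbourhood other than its own. -/
theorem disjoint_nbhd {i j : Fin n} (hij : i ≠ j) (hB : Disjoint (block T i) (block T j)) :
    Disjoint (nbhd T i) (nbhd T j) := by
  rw [Finset.disjoint_left]
  intro k hki hkj
  have hk : T k = ∅ := by
    rw [← Finset.disjoint_self_iff_empty]
    exact (hB.mono (subset_block T hki) (subset_block T hkj))
  simp only [nbhd, mem_filter, mem_univ, true_and, hk, Finset.disjoint_empty_right, not_true,
    or_false] at hki hkj
  exact hij (hki.symm.trans hkj)

theorem dependsOn_condChr (hT : ∀ k, DependsOn (fun x => h x k) (T k : Set (Fin m))) (i : Fin n)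
    (I : Finset (Fin m)) :
    DependsOn (condChr h ω (nbhd T i) I) (block T i : Set (Fin m)) := by
  intro x x' hxx
  unfold condChr
  congr 1
  funext y
  refine dependsOn_chr _ fun k hk => hT k fun a ha => ?_
  by_cases haI : a ∈ I
  · simp [haI]
  · simpa [haI] using hxx a (subset_block T hk ha)

/-- The character of the weight is bounded by the product of the conditional characters of the
weights of neighbourhoods with disjoint blocks. -/
theorem norm_bexp_chr_le (hω : ‖ω‖ = 1)
    (hT : ∀ k, DependsOn (fun x => h x k) (T k : Set (Fin m))) (R : Finset (Fin n))
    (hB : ∀ i ∈ R, ∀ j ∈ R, i ≠ j → Disjoint (block T i) (block T j)) :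
    ‖bexp (1 / 2) (fun x => chr ω univ (h x))‖
      ≤ ∏ i ∈ R, bexp (1 / 2) (fun x => ‖condChr h ω (nbhd T i) (T i) x‖) := by
  have h0 : (0 : ℝ) ≤ 1 / 2 := by norm_num
  have h1 : (1 / 2 : ℝ) ≤ 1 := by norm_num
  set I := R.biUnion T with hI
  set U := R.biUnion (nbhd T) with hU
  have hTB : ∀ i, T i ⊆ block T i := fun i => subset_block T (self_mem_nbhd T i)
  have hpd : (R : Set (Fin n)).PairwiseDisjoint (nbhd T) := fun i hi j hj hij =>
    disjoint_nbhd hij (hB i hi j hj hij)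
  have hsplit : ∀ z, chr ω univ z = chr ω Uᶜ z * ∏ i ∈ R, chr ω (nbhd T i) z := by
    intro z
    unfold chr
    rw [← Finset.prod_biUnion hpd, ← hU, mul_comm, Finset.prod_mul_prod_compl]
  -- An output outside all neighbourhoods reads none of the resampled inputs.
  have hout : ∀ x y, chr ω Uᶜ (h (I.piecewise y x)) = chr ω Uᶜ (h x) := by
    intro x y
    refine dependsOn_chr _ fun k hk => ?_
    refine piecewise_eq_of_dependsOn_disjoint (hT k) ?_ y x
    rw [hI, Finset.disjoint_biUnion_left]
    intro i hi
    by_contra hdis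
    refine (Finset.mem_compl.1 (Finset.mem_coe.1 hk)) (mem_biUnion.2 ⟨i, hi, ?_⟩)
    simp [nbhd, hdis]
  -- The neighbourhood of `i` reads only `block T i`, which meets no `T j` with `j ≠ i` in `R`.
  have hin : ∀ i ∈ R, ∀ x y, chr ω (nbhd T i) (h (I.piecewise y x))
      = chr ω (nbhd T i) (h ((T i).piecewise y x)) := by
    intro i hi x y
    refine dependsOn_chr _ fun k hk => hT k fun a ha => ?_
    by_cases haT : a ∈ T i
    · have : a ∈ I := mem_biUnion.2 ⟨i, hi, haT⟩
      simp [haT, this]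
    · have : a ∉ I := by
        intro haI
        obtain ⟨j, hj, haj⟩ := mem_biUnion.1 haI
        have hij : i ≠ j := by rintro rfl; exact haT haj
        exact Finset.disjoint_left.1 (hB i hi j hj hij) (subset_block T hk ha) (hTB j haj)
      simp [haT, this]
  have hdep : ∀ x, ∀ i ∈ R, DependsOn (fun y => chr ω (nbhd T i) (h ((T i).piecewise y x)))
      (T i : Set (Fin m)) := by
    intro x i _ y y' hyy
    have : (T i).piecewise y x = (T i).piecewise y' x := by
      funext a
      by_cases ha : a ∈ T i
      · simpa [ha] using hyy a ha
      · simp [ha]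
    simp only [this]
  have hinner : ∀ x, bexp (1 / 2) (fun y => chr ω univ (h (I.piecewise y x)))
      = chr ω Uᶜ (h x) * ∏ i ∈ R, condChr h ω (nbhd T i) (T i) x := by
    intro x
    have : (fun y => chr ω univ (h (I.piecewise y x)))
        = fun y => chr ω Uᶜ (h x) * ∏ i ∈ R, chr ω (nbhd T i) (h ((T i).piecewise y x)) := by
      funext y
      rw [hsplit, hout]
      congr 1
      exact Finset.prod_congr rfl fun i hi => hin i hi x y
    rw [this, bexp_mul_left, bexp_prod_of_disjoint R (hdep x) fun i hi j hj hij =>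
      (hB i hi j hj hij).mono (hTB i) (hTB j)]
    rfl
  rw [bexp_resample I]
  refine (norm_bexp_le h0 h1 _).trans_eq ?_
  simp only [hinner, norm_mul, norm_chr hω, one_mul, norm_prod]
  exact bexp_prod_of_disjoint R
    (fun i _ x y hxy => congrArg norm (dependsOn_condChr hT i (T i) hxy)) hB

/-- By Cauchy–Schwarz each factor is at most `√(1 - v) ≤ exp (-v / 2)`. -/
theorem norm_bexp_chr_le_exp (hω : ‖ω‖ = 1)
    (hT : ∀ k, DependsOn (fun x => h x k) (T k : Set (Fin m))) (R : Finset (Fin n))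
    (hB : ∀ i ∈ R, ∀ j ∈ R, i ≠ j → Disjoint (block T i) (block T j)) {v : ℝ}
    (hv : ∀ i ∈ R, v ≤ 1 - bexp (1 / 2) (fun x => ‖condChr h ω (nbhd T i) (T i) x‖ ^ 2)) :
    ‖bexp (1 / 2) (fun x => chr ω univ (h x))‖ ≤ Real.exp (-(R.card * (v / 2))) := by
  have h0 : (0 : ℝ) ≤ 1 / 2 := by norm_num
  have h1 : (1 / 2 : ℝ) ≤ 1 := by norm_num
  refine (norm_bexp_chr_le hω hT R hB).trans ?_
  have e : Real.exp (-(R.card * (v / 2))) = ∏ _j ∈ R, Real.exp (-(v / 2)) := by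
    rw [Finset.prod_const, ← Real.exp_nat_mul]; ring_nf
  rw [e]
  refine Finset.prod_le_prod (fun i _ => bexp_nonneg h0 h1 fun x => norm_nonneg _) fun i hi => ?_
  refine le_of_sq_le_sq ?_ (Real.exp_pos _).le
  refine (sq_bexp_le h0 h1 _).trans ?_
  rw [← Real.exp_nat_mul]
  have := Real.add_one_le_exp (((2 : ℕ) : ℝ) * -(v / 2))
  push_cast at this ⊢
  linarith [hv i hi]

end product

/-! ### Fourier inversion and smoothness of integer-valued random variables. -/

section fourier

open MeasureTheory intervalIntegral Real

theorem integral_exp_int (k : ℤ) :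
    ∫ θ in (-π)..π, Complex.exp (k * θ * Complex.I) = if k = 0 then 2 * (π : ℂ) else 0 := by
  split_ifs with hk
  · subst hk
    simp
    ring
  · have hk' : (k : ℂ) * Complex.I ≠ 0 := mul_ne_zero (Int.cast_ne_zero.2 hk) Complex.I_ne_zero
    have := integral_exp_mul_complex (a := -π) (b := π) hk'
    have e : ∀ θ : ℝ, (k : ℂ) * θ * Complex.I = k * Complex.I * θ := fun θ => by ring
    simp only [e]
    rw [this, div_eq_zero_iff]
    left
    rw [sub_eq_zero, Complex.exp_eq_exp_iff_exists_int]
    exact ⟨k, by push_cast; ring⟩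

theorem integral_mul_exp_neg_sq_le {b : ℝ} (hb : 0 < b) (c : ℝ) :
    ∫ u in (0 : ℝ)..c, 2 * u * exp (-(b * u ^ 2)) ≤ 1 / b := by
  have h : ∀ u ∈ Set.uIcc 0 c, HasDerivAt (fun u : ℝ => -(1 / b) * exp (-(b * u ^ 2)))
      (2 * u * exp (-(b * u ^ 2))) u := by
    intro u _
    have h1 : HasDerivAt (fun u : ℝ => -(b * u ^ 2)) (-(b * (2 * u))) u := by
      simpa using ((hasDerivAt_pow 2 u).const_mul b).fun_neg
    have h2 := (h1.exp).const_mul (-(1 / b))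
    refine h2.congr_deriv ?_
    field_simp
  rw [integral_eq_sub_of_hasDerivAt h (by
    apply Continuous.intervalIntegrable; fun_prop)]
  simp only [ne_eq, OfNat.ofNat_ne_zero, not_false_eq_true, zero_pow, mul_zero, neg_zero, exp_zero]
  have : 0 ≤ 1 / b * exp (-(b * c ^ 2)) := by positivity
  linarith

/-- By Jordan's inequality and `π ≤ 4`, `u ≤ 2 * sin u` on `[0, π / 2]`, so the integrand is at most
`2 * u * exp (-(a * u ^ 2))`, which has an explicit primitive. -/
theorem integral_sin_mul_exp_le {a : ℝ} (ha : 0 < a) :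
    ∫ u in (-(π / 2))..(π / 2), 2 * |sin u| * exp (-(a * (2 * |sin u|) ^ 2)) ≤ 4 / a := by
  set ψ : ℝ → ℝ := fun u => 2 * |sin u| * exp (-(a * (2 * |sin u|) ^ 2)) with hψ
  have hc : Continuous ψ := by fun_prop
  have hint : ∀ x y, IntervalIntegrable ψ volume x y := fun x y => hc.intervalIntegrable x y
  have hneg : ∫ u in (-(π / 2))..0, ψ u = ∫ u in (0 : ℝ)..(π / 2), ψ u := by
    have := intervalIntegral.integral_comp_neg (a := 0) (b := π / 2) ψ
    rw [neg_zero] at this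
    rw [← this]
    refine intervalIntegral.integral_congr fun u _ => ?_
    simp only [hψ, sin_neg, abs_neg]
  have hhalf : ∫ u in (0 : ℝ)..(π / 2), ψ u ≤ 1 / a := by
    refine le_trans ?_ (integral_mul_exp_neg_sq_le ha (π / 2))
    refine intervalIntegral.integral_mono_on (by positivity) (hint _ _)
      (by apply Continuous.intervalIntegrable; fun_prop) fun u hu => ?_
    have hs0 : 0 ≤ sin u := sin_nonneg_of_nonneg_of_le_pi hu.1 (by linarith [hu.2, pi_pos])
    have h1 : sin u ≤ u := sin_le hu.1
    have h2 : 2 / π * u ≤ sin u := mul_le_sin hu.1 hu.2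
    have h3 : u ≤ 2 * sin u := by
      have h4 : 1 / 2 ≤ 2 / π := by
        rw [div_le_div_iff₀ two_pos pi_pos]; linarith [pi_le_four]
      have := mul_le_mul_of_nonneg_right h4 hu.1
      linarith
    simp only [hψ, abs_of_nonneg hs0]
    refine mul_le_mul (by linarith) (exp_le_exp.2 (neg_le_neg ?_)) (exp_pos _).le
      (by linarith [hu.1])
    exact mul_le_mul_of_nonneg_left (pow_le_pow_left₀ hu.1 h3 2) ha.le
  rw [← intervalIntegral.integral_add_adjacent_intervals (hint _ 0) (hint 0 _), hneg]
  have : 1 / a + 1 / a ≤ 4 / a := by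
    rw [← add_div]; exact div_le_div_of_nonneg_right (by norm_num) ha.le
  linarith

/-- For `δ = 1` substitute `u = θ / 2`; for `δ = 2` the interval consists of two periods of `|sin|`.
-/
theorem integral_sin_smul_mul_exp_le {a : ℝ} (ha : 0 < a) {δ : ℕ} (hδ : δ = 1 ∨ δ = 2) :
    ∫ θ in (-π)..π, 2 * |sin (δ * θ / 2)| * exp (-(a * (2 * |sin (δ * θ / 2)|) ^ 2)) ≤ 8 / a := by
  set ψ : ℝ → ℝ := fun u => 2 * |sin u| * exp (-(a * (2 * |sin u|) ^ 2)) with hψ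
  have hc : Continuous ψ := by fun_prop
  have hint : ∀ x y, IntervalIntegrable ψ volume x y := fun x y => hc.intervalIntegrable x y
  have hmain : ∫ u in (-(π / 2))..(π / 2), ψ u ≤ 4 / a := integral_sin_mul_exp_le ha
  have h8 : 8 / a = 2 * (4 / a) := by ring
  rw [h8]
  rcases hδ with rfl | rfl
  · have : ∫ θ in (-π)..π, ψ (θ / 2) = 2 * ∫ u in (-(π / 2))..(π / 2), ψ u := by
      rw [intervalIntegral.integral_comp_div ψ two_ne_zero, smul_eq_mul, neg_div]
    simp only [Nat.cast_one, one_mul]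
    exact this.trans_le (by linarith)
  · have hper : Function.Periodic ψ π := fun u => by simp only [hψ, sin_add_pi, abs_neg]
    have e1 : ∫ u in (-π)..0, ψ u = ∫ u in (-(π / 2))..(π / 2), ψ u := by
      have := hper.intervalIntegral_add_eq (-π) (-(π / 2))
      rwa [neg_add_cancel, show -(π / 2) + π = π / 2 by ring] at this
    have e2 : ∫ u in (0 : ℝ)..π, ψ u = ∫ u in (-(π / 2))..(π / 2), ψ u := by
      have := hper.intervalIntegral_add_eq 0 (-(π / 2))
      rwa [zero_add, show -(π / 2) + π = π / 2 by ring] at this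
    have : ∫ θ in (-π)..π, ψ θ ≤ 2 * (4 / a) := by
      rw [← intervalIntegral.integral_add_adjacent_intervals (hint _ 0) (hint 0 _), e1, e2]
      linarith
    have e : ∀ θ : ℝ, ((2 : ℕ) : ℝ) * θ / 2 = θ := fun θ => by push_cast; ring
    simp only [e]
    exact this

theorem norm_exp_mul_I_sub_one (θ : ℝ) :
    ‖Complex.exp (θ * Complex.I) - 1‖ = 2 * |sin (θ / 2)| := by
  rw [mul_comm, Complex.norm_exp_I_mul_ofReal_sub_one, norm_mul, Real.norm_eq_abs,
    Real.norm_eq_abs, abs_two]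

variable {ι : Type*} [Fintype ι] [DecidableEq ι]

/-- Fourier inversion for an integer-valued random variable. -/
theorem two_pi_mul_bexp_eq (X : (ι → Bool) → ℕ) (w : ℤ) :
    ((2 * π * bexp (1 / 2) (fun x => if (X x : ℤ) = w then (1 : ℝ) else 0) : ℝ) : ℂ)
      = ∫ θ in (-π)..π, bexp (1 / 2) (fun x => Complex.exp (θ * Complex.I) ^ X x)
          * Complex.exp (-w * θ * Complex.I) := by
  have e : ∀ θ : ℝ, bexp (1 / 2) (fun x => Complex.exp (θ * Complex.I) ^ X x)
      * Complex.exp (-w * θ * Complex.I)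
      = ∑ x, bwt (1 / 2) x • Complex.exp (((X x - w : ℤ) : ℂ) * θ * Complex.I) := by
    intro θ
    rw [← bexp_mul_right]
    refine Finset.sum_congr rfl fun x _ => ?_
    beta_reduce
    rw [← Complex.exp_nat_mul, ← Complex.exp_add]
    congr 2
    push_cast
    ring
  simp only [e]
  rw [intervalIntegral.integral_finsetSum fun x _ => by
    apply Continuous.intervalIntegrable; fun_prop]
  simp only [intervalIntegral.integral_smul, integral_exp_int, bexp]
  rw [Finset.mul_sum]
  push_cast
  refine Finset.sum_congr rfl fun x _ => ?_
  by_cases hx : (X x : ℤ) = w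
  · simp [hx]; ring
  · simp [hx, sub_eq_zero]

/-- The shift by `δ` multiplies the integrand by a factor of modulus `‖ω ^ δ - 1‖`, which vanishes
where the Gaussian bound on the characteristic function is weakest. This gives order `1 / a` instead
of the `1 / √a` available for a single probability. -/
theorem abs_bexp_sub_bexp_le_of_char {a : ℝ} (ha : 0 < a) {δ : ℕ} (hδ : δ = 1 ∨ δ = 2)
    (X : (ι → Bool) → ℕ) (hX : ∀ ω : ℂ, ‖ω‖ = 1 →
      ‖bexp (1 / 2) (fun x => ω ^ X x)‖ ≤ exp (-(a * ‖ω ^ δ - 1‖ ^ 2))) (w : ℤ) :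
    |bexp (1 / 2) (fun x => if (X x : ℤ) = w then (1 : ℝ) else 0)
      - bexp (1 / 2) (fun x => if (X x : ℤ) = w + δ then (1 : ℝ) else 0)| ≤ 2 / a := by
  set P := bexp (1 / 2) (fun x => if (X x : ℤ) = w then (1 : ℝ) else 0)
  set Q := bexp (1 / 2) (fun x => if (X x : ℤ) = w + δ then (1 : ℝ) else 0)
  set φ : ℝ → ℂ := fun θ => bexp (1 / 2) (fun x => Complex.exp (θ * Complex.I) ^ X x) with hφ
  have hφc : Continuous φ := by
    simp only [hφ, bexp]; fun_prop
  have hdiff : ((2 * π * (P - Q) : ℝ) : ℂ)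
      = ∫ θ in (-π)..π, φ θ * (Complex.exp (-w * θ * Complex.I)
        - Complex.exp (-(w + δ : ℤ) * θ * Complex.I)) := by
    simp only [mul_sub]
    rw [Complex.ofReal_sub, two_pi_mul_bexp_eq, two_pi_mul_bexp_eq,
      intervalIntegral.integral_sub]
    · apply Continuous.intervalIntegrable; fun_prop
    · apply Continuous.intervalIntegrable; fun_prop
  have hbound : ∀ θ : ℝ, ‖φ θ * (Complex.exp (-w * θ * Complex.I)
        - Complex.exp (-(w + δ : ℤ) * θ * Complex.I))‖
      ≤ 2 * |sin (δ * θ / 2)| * exp (-(a * (2 * |sin (δ * θ / 2)|) ^ 2)) := by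
    intro θ
    have e1 : Complex.exp (-w * θ * Complex.I) - Complex.exp (-(w + δ : ℤ) * θ * Complex.I)
        = Complex.exp ((-(w + δ) * θ : ℝ) * Complex.I)
          * (Complex.exp ((δ * θ : ℝ) * Complex.I) - 1) := by
      rw [mul_sub, mul_one, ← Complex.exp_add]
      push_cast
      congr 2
      ring
    have e2 : Complex.exp (θ * Complex.I) ^ δ = Complex.exp ((δ * θ : ℝ) * Complex.I) := by
      rw [← Complex.exp_nat_mul]; push_cast; ring_nf
    have h1 := hX (Complex.exp (θ * Complex.I)) (Complex.norm_exp_ofReal_mul_I θ)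
    rw [e2, norm_exp_mul_I_sub_one] at h1
    rw [norm_mul, e1, norm_mul, Complex.norm_exp_ofReal_mul_I, one_mul, norm_exp_mul_I_sub_one,
      mul_comm]
    exact mul_le_mul_of_nonneg_left h1 (by positivity)
  have hle : ‖((2 * π * (P - Q) : ℝ) : ℂ)‖ ≤ 8 / a := by
    rw [hdiff]
    refine (intervalIntegral.norm_integral_le_of_norm_le (by linarith [pi_pos])
      (MeasureTheory.ae_of_all _ fun θ _ => hbound θ) ?_).trans
      (integral_sin_smul_mul_exp_le ha hδ)
    apply Continuous.intervalIntegrable; fun_prop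
  rw [Complex.norm_real, Real.norm_eq_abs, abs_mul, abs_of_pos two_pi_pos] at hle
  have h3 : 4 * |P - Q| ≤ 2 * π * |P - Q| :=
    mul_le_mul_of_nonneg_right (by linarith [pi_gt_three]) (abs_nonneg _)
  have e : 8 / a = 4 * (2 / a) := by ring
  linarith

end fourier


/-! ### Fixing inputs and splitting the output distribution. -/

section restrict

variable {m n : ℕ} {f : (Fin m → Bool) → (Fin n → Bool)}

/-- The function `f` with the inputs in `S` fixed to their values in `ρ`. -/
def fixInputs (f : (Fin m → Bool) → (Fin n → Bool)) (S : Finset (Fin m)) (ρ : Fin m → Bool)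
    (x : Fin m → Bool) : Fin n → Bool := f (S.piecewise ρ x)

theorem fixInputs_congr {S : Finset (Fin m)} {ρ ρ' : Fin m → Bool} (h : ∀ a ∈ S, ρ a = ρ' a) :
    fixInputs f S ρ = fixInputs f S ρ' := by
  funext x
  unfold fixInputs
  congr 1
  exact S.piecewise_congr h fun _ _ => rfl

theorem dependsOn_fixInputs {T : Fin n → Finset (Fin m)}
    (hT : ∀ k, DependsOn (fun x => f x k) (T k : Set (Fin m))) (S : Finset (Fin m))
    (ρ : Fin m → Bool) (k : Fin n) :
    DependsOn (fun x => fixInputs f S ρ x k) ((T k \ S : Finset (Fin m)) : Set (Fin m)) := by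
  intro x y hxy
  refine hT k fun a ha => ?_
  by_cases haS : a ∈ S
  · simp [haS]
  · simpa [haS] using hxy a (by simpa [haS] using ha)

theorem bwt_half (x : Fin m → Bool) : bwt (1 / 2) x = (1 / 2) ^ m := by
  rw [bwt_eq_pow, show (1 - 1 / 2 : ℝ) = 1 / 2 by norm_num, ← pow_add,
    Nat.add_sub_cancel' (hammingWeight_le x)]

theorem bexp_half (g : (Fin m → Bool) → ℝ) :
    bexp (1 / 2) g = (1 / 2) ^ m * ∑ x, g x := by
  simp only [bexp, bwt_half, smul_eq_mul, Finset.mul_sum]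

/-- Averaging over inputs in an event that only involves the bits in `S`. -/
theorem sum_eq_sum_bexp {U : Finset (Fin m → Bool)} {S : Finset (Fin m)}
    (hU : ∀ x y, S.piecewise x y ∈ U ↔ x ∈ U) (G : (Fin n → Bool) → ℝ) :
    ∑ x ∈ U, G (f x) = ∑ x ∈ U, bexp (1 / 2) (fun y => G (fixInputs f S x y)) := by
  have h := bexp_swap (p := 1 / 2) S fun x (_ : Fin m → Bool) => if x ∈ U then G (f x) else 0
  simp only [bexp_const, hU] at h
  have e : ∀ x, bexp (1 / 2) (fun y => if x ∈ U then G (f (S.piecewise x y)) else 0)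
      = if x ∈ U then bexp (1 / 2) (fun y => G (fixInputs f S x y)) else 0 := by
    intro x
    split_ifs
    · rfl
    · exact bexp_const 0
  simp only [e] at h
  rw [bexp_half, bexp_half] at h
  have h2 := mul_left_cancel₀ (by positivity : ((1 : ℝ) / 2) ^ m ≠ 0) h
  simpa only [Finset.sum_ite_mem, Finset.univ_inter] using h2

theorem toReal_map_uniformOfFinset {U : Finset (Fin m → Bool)} (hU : U.Nonempty)
    (y : Fin n → Bool) :
    (((PMF.uniformOfFinset U hU).map f) y).toReal = ((U.filter fun x => f x = y).card : ℝ) / U.card := by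
  classical
  rw [PMF.map_apply, tsum_fintype]
  simp only [PMF.uniformOfFinset_apply]
  rw [ENNReal.toReal_sum (fun x _ => by
    split_ifs <;> simp [hU.ne_empty])]
  rw [Finset.card_filter, Nat.cast_sum, Finset.sum_div, ← Finset.sum_subset (Finset.subset_univ U)
    (fun x _ hx => by simp [hx])]
  refine Finset.sum_congr rfl fun x hx => ?_
  by_cases hxy : y = f x
  · simp [hx, hxy]
  · simp [hxy, Ne.symm hxy]

theorem sum_toReal_map_uniformOfFinset {U : Finset (Fin m → Bool)} (hU : U.Nonempty)
    (A : Finset (Fin n → Bool)) :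
    ∑ y ∈ A, (((PMF.uniformOfFinset U hU).map f) y).toReal
      = (∑ x ∈ U, if f x ∈ A then (1 : ℝ) else 0) / U.card := by
  simp only [toReal_map_uniformOfFinset, ← Finset.sum_div]
  congr 1
  simp only [Finset.card_filter, Nat.cast_sum]
  rw [Finset.sum_comm]
  refine Finset.sum_congr rfl fun x _ => ?_
  simp

/-- Splitting the output distribution of `f` according to an event on the inputs. -/
theorem exists_isMixture (f : (Fin m → Bool) → (Fin n → Bool)) (U : Finset (Fin m → Bool))
    (E₀ W₀ : PMF (Fin n → Bool)) : ∃ E W : PMF (Fin n → Bool), IsMixture (outputDist f) E W ∧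
      (E = E₀ ∨ ∃ hU : U.Nonempty, E = (PMF.uniformOfFinset U hU).map f) ∧
      (W = W₀ ∨ ∃ hU : Uᶜ.Nonempty, W = (PMF.uniformOfFinset Uᶜ hU).map f) := by
  have hout : outputDist f = (PMF.uniformOfFinset univ univ_nonempty).map f := rfl
  -- If `U` or its complement is empty, that part gets mixing weight zero and may be any
  -- distribution; hence the defaults `E₀` and `W₀`.
  rcases U.eq_empty_or_nonempty with rfl | hU
  · have hne : (∅ᶜ : Finset (Fin m → Bool)).Nonempty := by simp
    refine ⟨E₀, _, ⟨0, le_rfl, zero_le_one, fun y => ?_⟩, Or.inl rfl, Or.inr ⟨hne, rfl⟩⟩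
    rw [hout, toReal_map_uniformOfFinset, toReal_map_uniformOfFinset, compl_empty]
    ring
  rcases (Uᶜ).eq_empty_or_nonempty with hU' | hU'
  · obtain rfl : U = univ := by simpa using hU'
    refine ⟨_, W₀, ⟨1, zero_le_one, le_rfl, fun y => ?_⟩, Or.inr ⟨hU, rfl⟩, Or.inl rfl⟩
    rw [hout]
    ring
  refine ⟨_, _, ⟨U.card / (univ : Finset (Fin m → Bool)).card, by positivity,
    div_le_one_of_le₀ (by exact_mod_cast Finset.card_le_univ U) (by positivity), fun y => ?_⟩,
    Or.inr ⟨hU, rfl⟩, Or.inr ⟨hU', rfl⟩⟩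
  rw [hout]
  simp only [toReal_map_uniformOfFinset]
  have h1 : (0 : ℝ) < U.card := by exact_mod_cast hU.card_pos
  have h2 : (0 : ℝ) < Uᶜ.card := by exact_mod_cast hU'.card_pos
  have h3 : ((univ : Finset (Fin m → Bool)).card : ℝ) = U.card + Uᶜ.card := by
    exact_mod_cast (Finset.card_add_card_compl U).symm
  have h4 : ((univ.filter fun x => f x = y).card : ℝ)
      = (U.filter fun x => f x = y).card + (Uᶜ.filter fun x => f x = y).card := by
    rw [← Nat.cast_add, ← Finset.card_union_of_disjoint
      (Finset.disjoint_filter_filter (disjoint_compl_right)), ← Finset.filter_union,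
      Finset.union_compl]
  rw [h3, h4]
  field_simp
  ring

/-- A distribution with uniformly distributed weight. -/
def uniformWeightDist (n : ℕ) : PMF (Fin n → Bool) :=
  (PMF.uniformOfFintype (Fin (n + 1))).map fun (k : Fin (n + 1)) (i : Fin n) => decide ((i : ℕ) < k)

theorem hammingWeight_decide_lt {k : ℕ} (hk : k ≤ n) :
    hammingWeight (fun i : Fin n => decide ((i : ℕ) < k)) = k := by
  unfold hammingWeight
  simp only [decide_eq_true_eq]
  rw [Fin.card_filter_val_lt]
  omega

theorem weightProb_uniformWeightDist (w : ℤ) :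
    weightProb (uniformWeightDist n) w = if 0 ≤ w ∧ w ≤ n then 1 / (n + 1 : ℝ) else 0 := by
  classical
  have e : ∀ x, ((uniformWeightDist n) x).toReal
      = ∑ k : Fin (n + 1), if x = (fun i : Fin n => decide ((i : ℕ) < k)) then 1 / (n + 1 : ℝ) else 0 := by
    intro x
    rw [uniformWeightDist, PMF.map_apply, tsum_fintype, ENNReal.toReal_sum (fun k _ => by
      split_ifs <;> simp)]
    refine Finset.sum_congr rfl fun k _ => ?_
    split_ifs
    · simp [ENNReal.toReal_add]
    · simp
  unfold weightProb
  simp only [e]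
  rw [Finset.sum_comm]
  have e2 : ∀ k : Fin (n + 1), (∑ x with (hammingWeight x : ℤ) = w,
      if x = (fun i : Fin n => decide ((i : ℕ) < k)) then 1 / (n + 1 : ℝ) else 0)
      = if ((k : ℕ) : ℤ) = w then 1 / (n + 1 : ℝ) else 0 := by
    intro k
    rw [Finset.sum_ite_eq']
    simp only [mem_filter, mem_univ, true_and,
      hammingWeight_decide_lt (Nat.lt_succ_iff.1 k.isLt)]
  simp only [e2]
  split_ifs with h
  · obtain ⟨k, rfl⟩ := Int.eq_ofNat_of_zero_le h.1
    have hk : k < n + 1 := by omega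
    rw [Finset.sum_eq_single ⟨k, hk⟩]
    · simp
    · intro b _ hb
      refine if_neg fun hbk => hb (Fin.ext (by exact_mod_cast hbk))
    · simp
  · refine Finset.sum_eq_zero fun k _ => if_neg fun hk => h ⟨by omega, ?_⟩
    have := k.isLt
    omega

/-- The weight probabilities take only the values `1 / (n + 1)` and `0`. This serves as the default
for `W`. -/
theorem abs_weightProb_uniformWeightDist_sub_le (hn : 0 < n) (w Δ : ℤ) :
    |weightProb (uniformWeightDist n) w - weightProb (uniformWeightDist n) (w + Δ)|
      ≤ (|Δ| : ℤ) / n := by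
  have hn' : (0 : ℝ) < n := by exact_mod_cast hn
  by_cases hΔ : Δ = 0
  · simp [hΔ]
  have h1 : (1 : ℝ) ≤ (|Δ| : ℤ) := by exact_mod_cast Int.one_le_abs hΔ
  have h2 : 1 / (n + 1 : ℝ) ≤ (|Δ| : ℤ) / n := div_le_div₀ (by linarith) h1 hn' (by linarith)
  have h3 : 0 ≤ 1 / (n + 1 : ℝ) := by positivity
  refine le_trans ?_ h2
  rw [weightProb_uniformWeightDist, weightProb_uniformWeightDist]
  split_ifs
  · rw [sub_self, abs_zero]; exact h3
  · rw [sub_zero, abs_of_nonneg h3]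
  · rw [zero_sub, abs_neg, abs_of_nonneg h3]
  · rw [sub_self, abs_zero]; exact h3

theorem weightProb_map_uniformOfFinset {U : Finset (Fin m → Bool)} (hU : U.Nonempty) (w : ℤ) :
    weightProb ((PMF.uniformOfFinset U hU).map f) w
      = (∑ x ∈ U, if (hammingWeight (f x) : ℤ) = w then (1 : ℝ) else 0) / U.card := by
  unfold weightProb
  rw [sum_toReal_map_uniformOfFinset]
  simp

theorem abs_sub_le_of_step {q : ℤ → ℝ} {δ : ℤ} {b : ℝ} (hq : ∀ w, |q w - q (w + δ)| ≤ b)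
    (w k : ℤ) : |q w - q (w + δ * k)| ≤ b * (|k| : ℤ) := by
  have hnat : ∀ (j : ℕ) (w : ℤ), |q w - q (w + δ * j)| ≤ b * j := by
    intro j
    induction j with
    | zero => simp
    | succ j ih =>
      intro w
      have h1 := ih w
      have h2 := hq (w + δ * j)
      have e : w + δ * ((j + 1 : ℕ) : ℤ) = w + δ * j + δ := by push_cast; ring
      rw [e]
      push_cast
      have := abs_sub_le (q w) (q (w + δ * j)) (q (w + δ * j + δ))
      linarith
  obtain ⟨j, rfl | rfl⟩ := Int.eq_nat_or_neg k
  · simpa using hnat j w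
  · have := hnat j (w + δ * -j)
    rw [abs_sub_comm]
    simpa using this

end restrict


/-! ### The dichotomy between right and wrong local laws. -/

section main

variable {m n : ℕ}

/-- A lower bound, up to the factor `‖ω ^ δ - 1‖ ^ 2`, for the conditional variance of the
character of the weight of a neighbourhood of size at most `K`. -/
def nondegConst (d K : ℕ) : ℝ :=
  ((1 / 2) ^ (2 * d)) ^ 2 * (((1 / 2) ^ (2 * d)) ^ 2) ^ K * (1 / 64 * (1 / 8) ^ K)

theorem nondegConst_pos (d K : ℕ) : 0 < nondegConst d K := by unfold nondegConst; positivity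

/-- The numbers `γ`, `1 - γ` and `|1 - 2 * γ|` are multiples of `2 ^ (-d)`, hence at least `2 ^
(-d)` when positive. -/
theorem dyadic_bounds {d : ℕ} {γ : ℝ} (hγ0 : 0 < γ) (hγ1 : γ < 1) {a : ℤ}
    (ha : γ = (a : ℝ) / 2 ^ d) :
    (1 / 2) ^ d ≤ γ ∧ (1 / 2) ^ (2 * d) ≤ γ * (1 - γ) ∧
      (γ ≠ 1 / 2 → (1 / 2) ^ (2 * d) ≤ |1 - 2 * γ|) := by
  have hp : (0 : ℝ) < (1 / 2) ^ d := by positivity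
  have hp1 : ((1 : ℝ) / 2) ^ d ≤ 1 := pow_le_one₀ (by norm_num) (by norm_num)
  have hq : (2 : ℝ) ^ d * (1 / 2) ^ d = 1 := by rw [← mul_pow]; norm_num
  have ha' : γ = a * (1 / 2) ^ d := by rw [ha]; field_simp; rw [one_div, inv_pow]; field_simp
  have key : ∀ z : ℤ, 0 < (z : ℝ) * (1 / 2) ^ d → (1 / 2) ^ d ≤ (z : ℝ) * (1 / 2) ^ d := by
    intro z hz
    have h1 : (0 : ℝ) < z := by
      by_contra! h
      exact absurd hz (not_lt.2 (mul_nonpos_of_nonpos_of_nonneg h hp.le))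
    have h2 : (1 : ℝ) ≤ z := by exact_mod_cast (Int.cast_pos.1 h1 : 0 < z)
    exact le_mul_of_one_le_left hp.le h2
  have h1 : (1 / 2) ^ d ≤ γ := by
    rw [ha'] at hγ0 ⊢; exact key a hγ0
  have h2 : (1 / 2) ^ d ≤ 1 - γ := by
    have e : 1 - γ = ((2 ^ d - a : ℤ) : ℝ) * (1 / 2) ^ d := by
      push_cast; rw [sub_mul, hq, ← ha']
    rw [e]
    exact key _ (by rw [← e]; linarith)
  refine ⟨h1, ?_, fun hγ => ?_⟩
  · rw [two_mul, pow_add]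
    exact mul_le_mul h1 h2 hp.le hγ0.le
  · have e : |1 - 2 * γ| = ((|2 ^ d - 2 * a| : ℤ) : ℝ) * (1 / 2) ^ d := by
      have e' : 1 - 2 * γ = (2 ^ d - 2 * a) * (1 / 2) ^ d := by
        rw [sub_mul, hq, mul_assoc, ← ha']
      rw [e', abs_mul, abs_of_pos hp]
      push_cast
      rfl
    have hpos : 0 < |1 - 2 * γ| := abs_pos.2 fun h => hγ (by linarith)
    refine le_trans ?_ (e ▸ key _ (e ▸ hpos))
    rw [two_mul, pow_add]
    exact mul_le_of_le_one_left hp.le hp1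

/-- Smoothness of the weight of `h` when many neighbourhoods with disjoint blocks have the
`γ`-biased law. -/
theorem abs_weight_sub_le {d K : ℕ} {γ : ℝ} (hγ0 : 0 < γ) (hγ1 : γ < 1) {a : ℤ}
    (ha : γ = (a : ℝ) / 2 ^ d) {h : (Fin m → Bool) → (Fin n → Bool)} {T : Fin n → Finset (Fin m)}
    (hT : ∀ k, DependsOn (fun x => h x k) (T k : Set (Fin m))) {R : Finset (Fin n)}
    (hB : ∀ i ∈ R, ∀ j ∈ R, i ≠ j → Disjoint (block T i) (block T j))
    (hK : ∀ i ∈ R, (nbhd T i).card ≤ K) (hlaw : ∀ i ∈ R, IsProductLaw h γ (nbhd T i))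
    (hR : R.Nonempty) (w : ℤ) :
    |bexp (1 / 2) (fun x => if (hammingWeight (h x) : ℤ) = w then (1 : ℝ) else 0)
      - bexp (1 / 2) (fun x => if (hammingWeight (h x) : ℤ) = w + ((if γ = 1 / 2 then 2 else 1 : ℕ))
        then (1 : ℝ) else 0)| ≤ 4 / (R.card * nondegConst d K) := by
  have hRpos : (0 : ℝ) < R.card := by exact_mod_cast hR.card_pos
  have hc := nondegConst_pos d K
  obtain ⟨-, hb2, hb3⟩ := dyadic_bounds hγ0 hγ1 ha
  have e : 4 / (R.card * nondegConst d K) = 2 / (R.card * nondegConst d K / 2) := by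
    field_simp; norm_num
  rw [e]
  refine abs_bexp_sub_bexp_le_of_char (by positivity) (by split_ifs <;> simp)
    (fun x => hammingWeight (h x)) (fun ω hω => ?_) w
  have hmain := norm_bexp_chr_le_exp (ω := ω) hω hT R hB
    (v := nondegConst d K * ‖ω ^ (if γ = 1 / 2 then 2 else 1 : ℕ) - 1‖ ^ 2) ?_
  · simp only [chr_univ] at hmain
    refine hmain.trans_eq ?_
    congr 1
    ring
  intro i hi
  have hκ1 : ((1 : ℝ) / 2) ^ (2 * d) ≤ 1 := pow_le_one₀ (by norm_num) (by norm_num)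
  split_ifs with hγ
  · subst hγ
    refine le_trans ?_ ((hlaw i hi).le_one_sub_bexp_half hω (self_mem_nbhd T i) (hT i) (hK i hi))
    refine mul_le_mul_of_nonneg_right ?_ (sq_nonneg _)
    unfold nondegConst
    -- `nondegConst` is the product of the constants for `γ ≠ 1 / 2` and `γ = 1 / 2`; both are at
    -- most `1`, and the one not needed is dropped.
    refine mul_le_of_le_one_left (by positivity) (mul_le_one₀ ?_ (by positivity) ?_)
    · exact pow_le_one₀ (by positivity) hκ1
    · exact pow_le_one₀ (by positivity) (pow_le_one₀ (by positivity) hκ1)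
  · rw [pow_one]
    refine le_trans ?_ ((hlaw i hi).le_one_sub_bexp_of_ne hω (self_mem_nbhd T i) (hT i)
      hγ0.le hγ1.le (by positivity) hκ1 hb2 (hb3 hγ) (hK i hi))
    refine mul_le_mul_of_nonneg_right ?_ (sq_nonneg _)
    unfold nondegConst
    refine mul_le_of_le_one_right (by positivity) (mul_le_one₀ (by norm_num) (by positivity) ?_)
    exact pow_le_one₀ (by norm_num) (by norm_num)

/-- A neighbourhood that does not have the `γ`-biased law is noticeably far from it, because all
probabilities involved are multiples of `2 ^ (-d t)`. -/
theorem exists_event_of_not_isProductLaw {d t : ℕ} {γ : ℝ} {a : ℤ}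
    (ha : γ = (a : ℝ) / 2 ^ d) {h : (Fin m → Bool) → (Fin n → Bool)} {N : Finset (Fin n)}
    {B : Finset (Fin m)} (hNB : ∀ k ∈ N, DependsOn (fun x => h x k) (B : Set (Fin m)))
    (hN : N.card ≤ t) (hB : B.card ≤ t * d) (hlaw : ¬ IsProductLaw h γ N) :
    ∃ A : (Fin n → Bool) → Bool, DependsOn A (N : Set (Fin n)) ∧
      bexp γ (ind A) + (1 / 2) ^ (d * t) ≤ bexp (1 / 2) (fun x => ind A (h x)) := by
  unfold IsProductLaw at hlaw
  push Not at hlaw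
  obtain ⟨A, hA, hne⟩ := hlaw
  have hint : ∀ y, ∃ z : ℤ, ind A y = z := fun y => by
    unfold ind
    split_ifs
    · exact ⟨1, by simp⟩
    · exact ⟨0, by simp⟩
  obtain ⟨z₁, h₁⟩ := exists_int_bexp (p := 1 / 2) (d := 1) (a := 1) (by norm_num) B
    (G := fun x => ind A (h x)) (fun x y hxy => by
      simp only [ind, hA fun k hk => hNB k (Finset.mem_coe.1 hk) hxy]) fun x => hint _
  obtain ⟨z₀, h₀⟩ := exists_int_bexp ha N (G := ind A) (fun x y hxy => by
      simp only [ind, hA hxy]) hint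
  have hcommon : ∀ (z : ℤ) (k : ℕ), k ≤ d * t →
      ∃ z' : ℤ, (z : ℝ) / 2 ^ k = z' * (1 / 2) ^ (d * t) := by
    intro z k hk
    refine ⟨z * 2 ^ (d * t - k), ?_⟩
    have : (2 : ℝ) ^ (d * t) = 2 ^ (d * t - k) * 2 ^ k := by rw [← pow_add]; congr 1; omega
    rw [one_div, inv_pow, this]
    push_cast
    field_simp
  obtain ⟨y₁, g₁⟩ := hcommon z₁ (1 * B.card) (by rw [one_mul, mul_comm d]; exact hB)
  obtain ⟨y₀, g₀⟩ := hcommon z₀ (d * N.card) (Nat.mul_le_mul_left d hN)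
  rw [g₁] at h₁
  rw [g₀] at h₀
  have hp : (0 : ℝ) < (1 / 2) ^ (d * t) := by positivity
  have hsep : ∀ y y' : ℤ, y < y' →
      (y : ℝ) * (1 / 2) ^ (d * t) + (1 / 2) ^ (d * t) ≤ y' * (1 / 2) ^ (d * t) := by
    intro y y' hy
    have : (y : ℝ) + 1 ≤ y' := by exact_mod_cast hy
    have := mul_le_mul_of_nonneg_right this hp.le
    linarith
  have hyne : y₀ ≠ y₁ := fun hy => hne (by rw [h₁, h₀, hy])
  rcases lt_or_gt_of_ne hyne with hlt | hlt
  · exact ⟨A, hA, by rw [h₁, h₀]; exact hsep _ _ hlt⟩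
  -- The event has to be more likely for `h` than under bias `γ`; if it is less likely, its
  -- complement is used.
  · refine ⟨fun y => !A y, fun x y hxy => by simp only [hA hxy], ?_⟩
    have hc : ∀ y, ind (fun y => !A y) y = 1 - ind A y := by
      intro y
      unfold ind
      cases hAy : A y <;> simp [hAy]
    have e₁ : bexp (1 / 2) (fun x => ind (fun y => !A y) (h x)) = 1 - y₁ * (1 / 2) ^ (d * t) := by
      simp only [hc]
      rw [bexp_sub, bexp_const, h₁]
    have e₀ : bexp γ (ind fun y => !A y) = 1 - y₀ * (1 / 2) ^ (d * t) := by
      rw [funext hc, bexp_sub, bexp_const, h₀]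
    rw [e₁, e₀]
    have := hsep _ _ hlt
    linarith

/-- The image picks one representative for each restriction to `S`, so this counts the tests in the
union bound. -/
theorem card_image_piecewise_le (U : Finset (Fin m → Bool)) (S : Finset (Fin m)) :
    (U.image fun x => S.piecewise x fun _ => false).card ≤ 2 ^ S.card := by
  rw [← Finset.card_powerset]
  refine Finset.card_le_card_of_injOn (fun x => S.filter fun a => x a = true) ?_ ?_
  · intro x _
    exact Finset.mem_coe.2 (Finset.mem_powerset.2 (Finset.filter_subset _ _))
  · intro x hx y hy hxy
    obtain ⟨x, -, rfl⟩ := Finset.mem_image.1 (Finset.mem_coe.1 hx)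
    obtain ⟨y, -, rfl⟩ := Finset.mem_image.1 (Finset.mem_coe.1 hy)
    funext a
    by_cases ha : a ∈ S
    · have := Finset.ext_iff.1 hxy a
      simp only [mem_filter, ha, true_and] at this
      exact Bool.eq_iff_iff.2 this
    · simp [ha]

theorem sum_biUnion_le_sum_sum {α β : Type*} [DecidableEq α] [DecidableEq β] (s : Finset α)
    (t : α → Finset β) {g : β → ℝ} (hg : ∀ y, 0 ≤ g y) :
    ∑ y ∈ s.biUnion t, g y ≤ ∑ a ∈ s, ∑ y ∈ t a, g y := by
  induction s using Finset.induction_on with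
  | empty => simp
  | insert a s ha ih =>
    rw [Finset.biUnion_insert, Finset.sum_insert ha]
    have h1 := Finset.sum_union_inter (s₁ := t a) (s₂ := s.biUnion t) (f := g)
    have h2 : 0 ≤ ∑ y ∈ t a ∩ s.biUnion t, g y := Finset.sum_nonneg fun y _ => hg y
    linarith

/-- If every restriction of `f` in `U` is separated from the product distributions of bias
close to `γ`, then `f` on `U` is far from every symmetric distribution of weight near `γ n`. -/
theorem le_tvDist_of_separating_tests {f : (Fin m → Bool) → (Fin n → Bool)}
    {U : Finset (Fin m → Bool)} (hUne : U.Nonempty) {S : Finset (Fin m)}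
    (hU : ∀ x y, S.piecewise x y ∈ U ↔ x ∈ U) (hn : 0 < n) {c r e : ℝ} (he : 0 ≤ e)
    (htest : ∀ ρ ∈ U, ∃ A : Finset (Fin n → Bool),
      bexp (1 / 2) (fun x => if fixInputs f S ρ x ∈ A then (0 : ℝ) else 1) ≤ e ∧
      ∀ w : ℕ, w ≤ n → |(w : ℝ) - c| ≤ r →
        bexp (w / n : ℝ) (fun y => if y ∈ A then (1 : ℝ) else 0) ≤ e)
    {D : PMF (Fin n → Bool)} (hD : IsSymmetricDist D) (hDw : HasWeightsWithin D c r) :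
    1 - e - 2 ^ S.card * ((n + 1) * e) ≤ tvDist ((PMF.uniformOfFinset U hUne).map f) D := by
  classical
  choose! A hA1 hA2 using htest
  set P := U.image fun x => S.piecewise x fun _ => false
  have hPU : ∀ ρ ∈ P, ρ ∈ U := by
    intro ρ hρ
    obtain ⟨x, hx, rfl⟩ := Finset.mem_image.1 hρ
    exact (hU x _).2 hx
  -- One test for all restrictions: `f` on `U` lies in `Q` whenever its own restriction passes its
  -- own test, and `D` pays a union bound over `P`.
  set Q := P.biUnion A
  have hUpos : (0 : ℝ) < U.card := by exact_mod_cast hUne.card_pos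
  have hE : 1 - e ≤ ∑ y ∈ Q, (((PMF.uniformOfFinset U hUne).map f) y).toReal := by
    rw [sum_toReal_map_uniformOfFinset, le_div_iff₀ hUpos]
    have h1 : ∑ x ∈ U, (if f x ∈ Q then (0 : ℝ) else 1) ≤ ∑ _x ∈ U, e := by
      rw [sum_eq_sum_bexp hU fun y => if y ∈ Q then (0 : ℝ) else 1]
      refine Finset.sum_le_sum fun x hx => ?_
      have hxP : S.piecewise x (fun _ => false) ∈ P := Finset.mem_image_of_mem _ hx
      refine le_trans ?_ (hA1 _ (hPU _ hxP))
      rw [fixInputs_congr (ρ := S.piecewise x fun _ => false) (ρ' := x)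
        fun a ha => by simp [ha]]
      refine bexp_mono (by norm_num) (by norm_num) fun y => ?_
      by_cases hy : fixInputs f S x y ∈ A (S.piecewise x fun _ => false)
      · have : fixInputs f S x y ∈ Q := Finset.mem_biUnion.2 ⟨_, hxP, hy⟩
        simp [hy, this]
      · simp only [hy, if_false]
        split_ifs <;> norm_num
    have h2 : ∑ x ∈ U, (if f x ∈ Q then (1 : ℝ) else 0)
        + ∑ x ∈ U, (if f x ∈ Q then (0 : ℝ) else 1) = U.card := by
      rw [← Finset.sum_add_distrib, Finset.card_eq_sum_ones, Nat.cast_sum]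
      refine Finset.sum_congr rfl fun x _ => ?_
      split_ifs <;> norm_num
    rw [Finset.sum_const, nsmul_eq_mul] at h1
    linarith
  have hDQ : ∑ y ∈ Q, (D y).toReal ≤ 2 ^ S.card * ((n + 1) * e) := by
    calc ∑ y ∈ Q, (D y).toReal ≤ ∑ ρ ∈ P, ∑ y ∈ A ρ, (D y).toReal :=
          sum_biUnion_le_sum_sum P A fun y => ENNReal.toReal_nonneg
      _ ≤ ∑ _ρ ∈ P, (n + 1) * e :=
          Finset.sum_le_sum fun ρ hρ => hD.sum_le hn hDw (A ρ) (hA2 ρ (hPU ρ hρ))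
      _ = P.card * ((n + 1) * e) := by rw [Finset.sum_const, nsmul_eq_mul]
      _ ≤ 2 ^ S.card * ((n + 1) * e) := by
          refine mul_le_mul_of_nonneg_right ?_ (by positivity)
          exact_mod_cast card_image_piecewise_le U S
  have := sum_sub_sum_le_tvDist ((PMF.uniformOfFinset U hUne).map f) D Q
  linarith

end main


/-! ### Numerical estimates and degenerate cases. -/

section final

theorem add_two_le_exp {c x : ℝ} (hc : 0 < c) (hx : 8 / c ^ 2 ≤ x) (hx1 : 1 ≤ x) :
    x + 2 ≤ Real.exp (c * x) := by
  have h1 : c * x / 2 + 1 ≤ Real.exp (c * x / 2) := Real.add_one_le_exp _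
  have h2 : Real.exp (c * x) = Real.exp (c * x / 2) ^ 2 := by
    rw [← Real.exp_nat_mul]; congr 1; push_cast; ring
  have h3 : 8 ≤ x * c ^ 2 := (div_le_iff₀ (by positivity)).1 hx
  have h4 : (c * x / 2 + 1) ^ 2 ≤ Real.exp (c * x / 2) ^ 2 :=
    pow_le_pow_left₀ (by positivity) h1 2
  have h5 : 8 * x ≤ x * c ^ 2 * x := mul_le_mul_of_nonneg_right h3 (by linarith)
  have h6 : 0 < c * x := by positivity
  rw [h2]
  nlinarith

theorem rpow_two_thirds_le {η x : ℝ} (hη : 0 < η) (hx : (η⁻¹) ^ 3 ≤ x) :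
    x ^ (2 / 3 : ℝ) ≤ η * x := by
  have hx0 : 0 < x := lt_of_lt_of_le (by positivity) hx
  have h1 : η⁻¹ ≤ x ^ (1 / 3 : ℝ) := by
    have := Real.rpow_le_rpow (by positivity) hx (by norm_num : (0 : ℝ) ≤ 1 / 3)
    rwa [← Real.rpow_natCast, ← Real.rpow_mul (by positivity),
      show ((3 : ℕ) : ℝ) * (1 / 3) = 1 by norm_num, Real.rpow_one] at this
  have h2 : x = x ^ (2 / 3 : ℝ) * x ^ (1 / 3 : ℝ) := by
    rw [← Real.rpow_add hx0]; norm_num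
  have h3 : 1 ≤ η * x ^ (1 / 3 : ℝ) := by
    exact (mul_inv_cancel₀ hη.ne').symm.trans_le (mul_le_mul_of_nonneg_left h1 hη.le)
  have h4 : 0 ≤ x ^ (2 / 3 : ℝ) := by positivity
  calc x ^ (2 / 3 : ℝ) ≤ x ^ (2 / 3 : ℝ) * (η * x ^ (1 / 3 : ℝ)) := le_mul_of_one_le_right h4 h3
    _ = η * (x ^ (2 / 3 : ℝ) * x ^ (1 / 3 : ℝ)) := by ring
    _ = η * x := by rw [← h2]

/-- Half of the exponent `2 * x` absorbs `2 ^ s ≤ exp x`; the total error is then at most `(n + 2) *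
exp (-x)`. -/
theorem one_sub_exp_le_of_tests {n s : ℕ} {x c : ℝ} (hs : s ≤ x) (hx : 2 * (c * n) ≤ x)
    (hn : n + 2 ≤ Real.exp (c * n)) :
    1 - Real.exp (-(c * n))
      ≤ 1 - Real.exp (-(2 * x)) - 2 ^ s * ((n + 1) * Real.exp (-(2 * x))) := by
  have hx0 : 0 ≤ x := (Nat.cast_nonneg s).trans hs
  have h1 : (2 : ℝ) ^ s ≤ Real.exp x := by
    have h2 : (2 : ℝ) ≤ Real.exp 1 := by linarith [Real.add_one_le_exp (1 : ℝ)]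
    calc (2 : ℝ) ^ s ≤ Real.exp 1 ^ s := pow_le_pow_left₀ (by norm_num) h2 s
      _ = Real.exp s := by rw [← Real.exp_nat_mul, mul_one]
      _ ≤ Real.exp x := Real.exp_le_exp.2 hs
  have h2 : Real.exp (-(2 * x)) = Real.exp (-x) * Real.exp (-x) := by
    rw [← Real.exp_add]; ring_nf
  have h3 : Real.exp x * Real.exp (-x) = 1 := by rw [← Real.exp_add]; simp
  have h4 : Real.exp (-x) ≤ 1 := Real.exp_le_one_iff.2 (by linarith)
  have h5 : (2 : ℝ) ^ s * ((n + 1) * Real.exp (-(2 * x))) ≤ (n + 1) * Real.exp (-x) := by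
    calc (2 : ℝ) ^ s * ((n + 1) * Real.exp (-(2 * x)))
        ≤ Real.exp x * ((n + 1) * Real.exp (-(2 * x))) :=
          mul_le_mul_of_nonneg_right h1 (by positivity)
      _ = (n + 1) * (Real.exp x * Real.exp (-x)) * Real.exp (-x) := by rw [h2]; ring
      _ = _ := by rw [h3, mul_one]
  have h6 : Real.exp (-(2 * x)) ≤ Real.exp (-x) := by
    rw [h2]; exact mul_le_of_le_one_left (Real.exp_pos _).le h4
  have h7 : (n + 2) * Real.exp (-x) ≤ Real.exp (-(c * n)) := by
    calc (n + 2) * Real.exp (-x) ≤ Real.exp (c * n) * Real.exp (-(2 * (c * n))) :=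
          mul_le_mul hn (Real.exp_le_exp.2 (by linarith)) (Real.exp_pos _).le (Real.exp_pos _).le
      _ = Real.exp (-(c * n)) := by rw [← Real.exp_add]; ring_nf
  linarith

/-- The zero string has weight too small for the support of `D`, so its point mass can be the
default for `E`. -/
theorem le_tvDist_pure {n : ℕ} (D : PMF (Fin n → Bool)) {c r : ℝ} (hD : HasWeightsWithin D c r)
    (hcr : r < c) : 1 ≤ tvDist (PMF.pure fun _ => false) D := by
  classical
  have h0 : D (fun _ => false) = 0 := by
    by_contra h
    have := hD _ ((PMF.mem_support_iff _ _).2 h)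
    have e : hammingWeight (fun _ : Fin n => false) = 0 := by simp [hammingWeight]
    rw [e, Nat.cast_zero, zero_sub, abs_neg] at this
    linarith [le_abs_self c]
  have := sum_sub_sum_le_tvDist (PMF.pure fun _ => false) D {fun _ => false}
  simpa [h0] using this

/-- Smoothness of the weight of `f` on the inputs in `U`, when the restrictions of `f` in `U` have
smooth weights. -/
theorem abs_weightProb_sub_le {m n : ℕ} {f : (Fin m → Bool) → (Fin n → Bool)}
    {U : Finset (Fin m → Bool)} (hUne : U.Nonempty) {S : Finset (Fin m)}
    (hU : ∀ x y, S.piecewise x y ∈ U ↔ x ∈ U) {b : ℝ} {w w' : ℤ}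
    (hb : ∀ ρ ∈ U,
      |bexp (1 / 2) (fun x => if (hammingWeight (fixInputs f S ρ x) : ℤ) = w then (1 : ℝ) else 0)
        - bexp (1 / 2) (fun x => if (hammingWeight (fixInputs f S ρ x) : ℤ) = w'
          then (1 : ℝ) else 0)| ≤ b) :
    |weightProb ((PMF.uniformOfFinset U hUne).map f) w
      - weightProb ((PMF.uniformOfFinset U hUne).map f) w'| ≤ b := by
  have hUpos : (0 : ℝ) < U.card := by exact_mod_cast hUne.card_pos
  rw [weightProb_map_uniformOfFinset, weightProb_map_uniformOfFinset, ← sub_div, abs_div,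
    abs_of_pos hUpos, div_le_iff₀ hUpos,
    sum_eq_sum_bexp hU fun y => if (hammingWeight y : ℤ) = w then (1 : ℝ) else 0,
    sum_eq_sum_bexp hU fun y => if (hammingWeight y : ℤ) = w' then (1 : ℝ) else 0,
    ← Finset.sum_sub_distrib]
  refine (Finset.abs_sum_le_sum_abs _ _).trans ((Finset.sum_le_sum hb).trans_eq ?_)
  rw [Finset.sum_const, nsmul_eq_mul, mul_comm]

end final

end
-- Choice of the constants and conclusion.
theorem mainTheorem4 (d : ℕ) :
    ∃ c C : ℝ, 0 < c ∧ 0 < C ∧ ∃ N : ℕ, ∀ (n : ℕ), N ≤ n →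
      ∀ (m : ℕ) (f : (Fin m → Bool) → (Fin n → Bool)), IsLocal d f →
      ∀ γ : ℝ, 0 < γ → γ < 1 → (∃ a : ℤ, γ = (a : ℝ) / 2 ^ d) →
      ∃ E W : PMF (Fin n → Bool),
        IsMixture (outputDist f) E W ∧
        (∀ D : PMF (Fin n → Bool), IsSymmetricDist D →
          HasWeightsWithin D (γ * n) ((n : ℝ) ^ (2 / 3 : ℝ)) →
          1 - Real.exp (-(c * n)) ≤ tvDist E D) ∧
        (∀ w : ℕ, w ≤ n → ∀ Δ : ℤ, (γ = 1 / 2 → Even Δ) →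
          |weightProb W w - weightProb W (w + Δ)| ≤ C * (|Δ| : ℤ) / n) := by
  classical
  -- The test gap is `εt = 2 ^ (-d * t)`, so this factor makes `S.card ≤ x = R.card * εt ^ 2 / 256`.
  -- With at least half of `R` bad, the tests have error at most `exp (-2 * x)`.
  obtain ⟨K, hK0, hblocks⟩ := exists_disjoint_blocks d (fun t => 256 * 4 ^ (d * t))
    fun t => Nat.one_le_iff_ne_zero.2 (by positivity)
  have hKr : (0 : ℝ) < K := by exact_mod_cast hK0
  set ε : ℝ := (1 / 2) ^ (d * K) with hε
  have hε0 : 0 < ε := by positivity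
  have hε1 : ε ≤ 1 := pow_le_one₀ (by norm_num) (by norm_num)
  set c : ℝ := ε ^ 2 / (512 * K) with hc
  have hc0 : 0 < c := by positivity
  set ν := nondegConst d K with hν
  have hν0 : 0 < ν := nondegConst_pos d K
  -- A bias within `η` of `γ` satisfies the closeness condition of the tests, and `η < 2 ^ (-d) ≤ γ`
  -- keeps weight `0` outside the allowed window.
  set η : ℝ := ε / (4 * K) * (1 / 2) ^ (d + 1) with hη
  have hη0 : 0 < η := by positivity
  -- At least half of `R`, so at least `n / (2 * K)` neighbourhoods, are good for `W`, which turns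
  -- `4 / (good.card * ν)` into `8 * K / ν / n`; the `+ 1` covers the default `W`. The threshold on
  -- `n` ensures `n + 2 ≤ exp (c * n)` and `n ^ (2 / 3) ≤ η * n`.
  refine ⟨c, 8 * K / ν + 1, hc0, by positivity,
    ⌈8 / c ^ 2⌉₊ + ⌈(η⁻¹) ^ 3⌉₊ + 1, fun n hn m f hf γ hγ0 hγ1 ⟨a, ha⟩ => ?_⟩
  have hn0 : 0 < n := by omega
  have hn1 : (1 : ℝ) ≤ n := by exact_mod_cast hn0
  have hnr : (0 : ℝ) < n := by linarith
  have hexp : (n : ℝ) + 2 ≤ Real.exp (c * n) :=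
    add_two_le_exp hc0 ((Nat.le_ceil _).trans (by exact_mod_cast (by omega))) hn1
  have hrad : (n : ℝ) ^ (2 / 3 : ℝ) ≤ η * n :=
    rpow_two_thirds_le hη0 ((Nat.le_ceil _).trans (by exact_mod_cast (by omega)))
  obtain ⟨hγd, -, -⟩ := dyadic_bounds hγ0 hγ1 ha
  choose T hTcard hTdep using hf
  obtain ⟨t, htK, S, R, hnb, hdis, hS, hR⟩ := hblocks n m T hTcard
  set T' : Fin n → Finset (Fin m) := fun i => T i \ S with hT'
  have hT'card : ∀ i, (T' i).card ≤ d :=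
    fun i => (Finset.card_le_card Finset.sdiff_subset).trans (hTcard i)
  have hT'dep : ∀ ρ k, DependsOn (fun x => fixInputs f S ρ x k) (T' k : Set (Fin m)) :=
    fun ρ k => dependsOn_fixInputs hTdep S ρ k
  have hRr : (n : ℝ) ≤ K * R.card := by exact_mod_cast hR
  have hRpos : (0 : ℝ) < R.card := by
    by_contra! h
    nlinarith
  let bad : (Fin m → Bool) → Finset (Fin n) := fun ρ =>
    R.filter fun i => ¬ IsProductLaw (fixInputs f S ρ) γ (nbhd T' i)
  let U : Finset (Fin m → Bool) := univ.filter fun ρ => R.card ≤ 2 * (bad ρ).card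
  -- Membership in `U` involves only the bits in `S`, so conditioning on it leaves the other inputs
  -- uniform.
  have hU : ∀ x y, S.piecewise x y ∈ U ↔ x ∈ U := by
    intro x y
    have e : fixInputs f S (S.piecewise x y) = fixInputs f S x :=
      fixInputs_congr fun a ha => by simp [ha]
    simp only [U, bad, mem_filter, mem_univ, true_and, e]
  have hUc : ∀ x y, S.piecewise x y ∈ Uᶜ ↔ x ∈ Uᶜ := fun x y => by
    rw [mem_compl, mem_compl, hU]
  obtain ⟨E, W, hmix, hE, hW⟩ := exists_isMixture f U (PMF.pure fun _ => false)
    (uniformWeightDist n)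
  refine ⟨E, W, hmix, fun D hD hDw => ?_, fun w _ Δ hΔ => ?_⟩
  · rcases hE with rfl | ⟨hUne, rfl⟩
    · have hlt : (n : ℝ) ^ (2 / 3 : ℝ) < γ * n := by
        refine hrad.trans_lt (mul_lt_mul_of_pos_right (lt_of_lt_of_le ?_ hγd) hnr)
        have h1 : ε / (4 * K) ≤ 1 := by
          rw [div_le_one (by positivity)]
          have : (1 : ℝ) ≤ K := by exact_mod_cast hK0
          linarith
        have hp : (0 : ℝ) < (1 / 2) ^ d := by positivity
        calc η ≤ 1 * (1 / 2) ^ (d + 1) := mul_le_mul_of_nonneg_right h1 (by positivity)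
          _ < (1 / 2) ^ d := by rw [pow_succ]; linarith
      have := le_tvDist_pure D hDw hlt
      linarith [Real.exp_pos (-(c * n))]
    set εt : ℝ := (1 / 2) ^ (d * t) with hεt
    have hεt0 : 0 < εt := by positivity
    have hεle : ε ≤ εt :=
      pow_le_pow_of_le_one (by norm_num) (by norm_num) (Nat.mul_le_mul_left d htK)
    set x : ℝ := R.card * (εt ^ 2 / 256) with hx
    have hSx : (S.card : ℝ) ≤ x := by
      have h1 : (256 * 4 ^ (d * t) * S.card : ℝ) ≤ R.card := by exact_mod_cast hS
      have h2 : εt ^ 2 * 4 ^ (d * t) = 1 := by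
        rw [hεt, ← pow_mul, mul_comm _ 2, pow_mul, ← mul_pow]; norm_num
      have h3 := mul_le_mul_of_nonneg_right h1 (by positivity : 0 ≤ εt ^ 2 / 256)
      calc (S.card : ℝ) = S.card * (εt ^ 2 * 4 ^ (d * t)) := by rw [h2, mul_one]
        _ = 256 * 4 ^ (d * t) * S.card * (εt ^ 2 / 256) := by ring
        _ ≤ x := h3
    have hcx : 2 * (c * n) ≤ x := by
      have h1 : ε ^ 2 ≤ εt ^ 2 := pow_le_pow_left₀ hε0.le hεle 2
      calc 2 * (c * n) = n / K * (ε ^ 2 / 256) := by rw [hc]; field_simp; ring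
        _ ≤ R.card * (εt ^ 2 / 256) := by
          refine mul_le_mul ?_ (by linarith) (by positivity) (by positivity)
          rw [div_le_iff₀ hKr]; linarith
    refine (one_sub_exp_le_of_tests hSx hcx hexp).trans
      (le_tvDist_of_separating_tests hUne hU hn0 (Real.exp_pos _).le ?_ hD hDw)
    intro ρ hρ
    have hbadR : ∀ i ∈ bad ρ, i ∈ R := fun i hi => (mem_filter.1 hi).1
    have hbadB : ∀ i ∈ bad ρ, ∀ j ∈ bad ρ, i ≠ j → Disjoint (block T' i) (block T' j) :=
      fun i hi j hj hij => hdis i (hbadR i hi) j (hbadR j hj) hij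
    have hNB : ∀ i ∈ bad ρ, ∀ k ∈ nbhd T' i,
        DependsOn (fun x => fixInputs f S ρ x k) (block T' i : Set (Fin m)) :=
      fun i _ k hk x y hxy => hT'dep ρ k fun b hb => hxy b (subset_block T' hk hb)
    obtain ⟨A, hA1, hA2⟩ := exists_separating_test (h := fixInputs f S ρ) hγ0.le hγ1.le hεt0.le
      (bad ρ) (fun i hi j hj hij => disjoint_nbhd hij (hbadB i hi j hj hij)) hbadB hNB
      (fun i hi => hnb i (hbadR i hi))
      (fun i hi => exists_event_of_not_isProductLaw ha (hNB i hi) (hnb i (hbadR i hi))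
        (card_block_le hT'card (hnb i (hbadR i hi))) (mem_filter.1 hi).2)
    have hle : Real.exp (-((bad ρ).card * (εt ^ 2 / 64))) ≤ Real.exp (-(2 * x)) := by
      refine Real.exp_le_exp.2 (neg_le_neg ?_)
      have h1 : (R.card : ℝ) ≤ 2 * (bad ρ).card := by exact_mod_cast (mem_filter.1 hρ).2
      have h2 := mul_le_mul_of_nonneg_right h1 (by positivity : 0 ≤ εt ^ 2 / 128)
      rw [hx]
      linarith
    refine ⟨A, hA1.trans hle, fun w hwn hw => (hA2 _ (by positivity)
      ((div_le_one hnr).2 (by exact_mod_cast hwn)) ?_).trans hle⟩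
    have h1 : |(w / n : ℝ) - γ| ≤ η := by
      have e : (w / n : ℝ) - γ = (w - γ * n) / n := by field_simp
      rw [e, abs_div, abs_of_pos hnr, div_le_iff₀ hnr]
      exact hw.trans hrad
    have h2 : η ≤ ε / (4 * K) :=
      mul_le_of_le_one_right (by positivity) (pow_le_one₀ (by norm_num) (by norm_num))
    calc (t : ℝ) * |(w / n : ℝ) - γ| ≤ K * (ε / (4 * K)) :=
          mul_le_mul (by exact_mod_cast htK) (h1.trans h2) (abs_nonneg _) hKr.le
      _ = ε / 4 := by field_simp
      _ ≤ εt / 4 := by linarith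
  · have hΔ0 : (0 : ℝ) ≤ (|Δ| : ℤ) := by exact_mod_cast abs_nonneg Δ
    rcases hW with rfl | ⟨hUne, rfl⟩
    · refine (abs_weightProb_uniformWeightDist_sub_le hn0 w Δ).trans ?_
      refine div_le_div_of_nonneg_right (le_mul_of_one_le_left hΔ0 ?_) hnr.le
      have : 0 ≤ 8 * K / ν := by positivity
      linarith
    set q := weightProb ((PMF.uniformOfFinset Uᶜ hUne).map f) with hq
    have hstep : ∀ v : ℤ, |q v - q (v + ((if γ = 1 / 2 then 2 else 1 : ℕ)))| ≤ 8 * K / ν / n := by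
      intro v
      refine abs_weightProb_sub_le hUne hUc fun ρ hρ => ?_
      set good := R.filter fun i => IsProductLaw (fixInputs f S ρ) γ (nbhd T' i) with hgood
      have hsum : good.card + (bad ρ).card = R.card :=
        Finset.card_filter_add_card_filter_not _
      have hlt : 2 * (bad ρ).card < R.card := by
        rw [mem_compl] at hρ
        simpa [U] using hρ
      have hgR : ∀ i ∈ good, i ∈ R := fun i hi => (mem_filter.1 hi).1
      have hgpos : 0 < good.card := by omega
      have hg : (R.card : ℝ) ≤ 2 * good.card := by exact_mod_cast (by omega)
      refine (abs_weight_sub_le hγ0 hγ1 ha (hT'dep ρ) (R := good) (K := K)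
        (fun i hi j hj hij => hdis i (hgR i hi) j (hgR j hj) hij)
        (fun i hi => (hnb i (hgR i hi)).trans htK) (fun i hi => (mem_filter.1 hi).2)
        (Finset.card_pos.1 hgpos) v).trans ?_
      have hgr : (0 : ℝ) < good.card := by exact_mod_cast hgpos
      rw [← hν, div_div, div_le_div_iff₀ (by positivity) (by positivity)]
      have h1 : (n : ℝ) ≤ K * (2 * good.card) :=
        hRr.trans (mul_le_mul_of_nonneg_left hg hKr.le)
      have h2 := mul_le_mul_of_nonneg_left h1 (by positivity : 0 ≤ 4 * ν)
      linarith
    obtain ⟨k, hk1, hk2⟩ : ∃ k : ℤ, ((if γ = 1 / 2 then 2 else 1 : ℕ) : ℤ) * k = Δ ∧ |k| ≤ |Δ| := by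
      by_cases hγ : γ = 1 / 2
      · obtain ⟨k, hk⟩ := hΔ hγ
        refine ⟨k, by rw [if_pos hγ, hk]; push_cast; ring, ?_⟩
        rw [hk, ← two_mul, abs_mul, abs_two]
        linarith [abs_nonneg k]
      · exact ⟨Δ, by rw [if_neg hγ]; simp, le_rfl⟩
    have hmain := abs_sub_le_of_step hstep w k
    rw [hk1] at hmain
    refine hmain.trans ?_
    have h1 : ((|k| : ℤ) : ℝ) ≤ (|Δ| : ℤ) := by exact_mod_cast hk2
    calc 8 * K / ν / n * (|k| : ℤ) ≤ 8 * K / ν / n * (|Δ| : ℤ) :=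
          mul_le_mul_of_nonneg_left h1 (by positivity)
      _ = 8 * K / ν * (|Δ| : ℤ) / n := by ring
      _ ≤ _ := div_le_div_of_nonneg_right (mul_le_mul_of_nonneg_right (by linarith) hΔ0) hnr.le
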